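/- Let $M\ge 1$ be an integer and let $\Omega_M=\{0,1,\dots,M\}^{\mathbb N}$, where $\mathbb N=\{1,2,\dots\}$. For $q\in(1,M+1]$ and $(x_i)\in\Omega_M$ put $\pi_q((x_i))=\sum_{i\ge1}x_iq^{-i}$; the sequence $(x_i)$ is called a $q$-expansion of the number $\pi_q((x_i))$. Let $\mathcal U_q$ be the set of all numbers in $[0,M/(q-1)]$ that have exactly one $q$-expansion, and let $\mathbf U_q=\{(x_i)\in\Omega_M:\pi_q((x_i))\in\mathcal U_q\}$. For $X\subset\Omega_M$ let $B_m(X)$ be the set of prefixes of length $m$ of sequences from $X$, and put $h(X)=\lim_{m\to\infty}\frac1m\log\#B_m(X)$ whenever the limit exists ($\log$ is the natural logarithm). Put $H(q)=h(\mathbf U_q)$. Let $\alpha(q)$ denote the quasi-greedy $q$-expansion of $1$, that is, the lexicographically largest $q$-expansion of $1$ that does not end with $0^\infty$. For $i\ge0$ let $\tau_i\in\{0,1\}$ be the parity of the sum of the binary digits of $i$, and for $i\ge1$ let $\lambda_i=k+\tau_i-\tau_{i-1}$ if $M=2k$ and $\lambda_i=k+\tau_i$ if $M=2k+1$. For $n\in\mathbb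 N$ let $L=2^{n-1}$ if $M$ is even and $L=2^n$ if $M$ is odd, and let $q_n'=q_n'(M)\in(1,M+1]$ be the base with $$\alpha(q_n')=\lambda_1\dots\lambda_L\big(\overline{\lambda_1\dots\lambda_L}^{\,+}\big)^\infty,$$ where $\overline{c_1\dots c_L}^{\,+}=(M-c_1)\dots(M-c_{L-1})(M-c_L+1)$. Put $q_T=q_1'$, and let $c_M=1$ if $M$ is even and $c_M=\frac12$ if $M$ is odd. Then for every $n\in\mathbb N$ the base $q_n'$ exists and is unique, the limit defining $H(q_n')$ exists, and $$H(q_n')=\frac{c_M\log 2}{2^{n-1}}.$$ In particular, $H(q_T)=c_M\log2$. -/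

import Mathlib

open Filter Topology

noncomputable section

namespace NonIntegerBase

/-- Infinite sequences over the alphabet `{0, 1, …, M}`. The digit with index `i` here is the
digit `x_{i+1}` in one-based notation. -/
abbrev Seq (M : ℕ) : Type := ℕ → Fin (M + 1)

/-- The value `∑_{i ≥ 1} x_i / q^i` of a sequence in base `q` (only used for `q > 1`, where the
series converges). -/
def value (M : ℕ) (q : ℝ) (x : Seq M) : ℝ :=
  ∑' i : ℕ, ((x i : ℕ) : ℝ) / q ^ (i + 1)

/-- The univoque set: numbers in `[0, M / (q - 1)]` with exactly one expansion in base `q`. -/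
def univoqueSet (M : ℕ) (q : ℝ) : Set ℝ :=
  {t | t ∈ Set.Icc 0 ((M : ℝ) / (q - 1)) ∧ ∃! x : Seq M, value M q x = t}

/-- The symbolic univoque set: the sequences whose value lies in the univoque set. -/
def symbolicUnivoqueSet (M : ℕ) (q : ℝ) : Set (Seq M) :=
  {x | value M q x ∈ univoqueSet M q}

/-- The set `B_m(X)` of all prefixes of length `m` of sequences from `X`. -/
def prefixes {M : ℕ} (m : ℕ) (X : Set (Seq M)) : Set (Fin m → Fin (M + 1)) :=
  {w | ∃ x ∈ X, ∀ i : Fin m, w i = x i}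

/-- `HasEntropy X h` says that the limit defining the topological entropy of `X`, namely
`lim_{m → ∞} log (#B_m(X)) / m`, exists and equals `h`. -/
def HasEntropy {M : ℕ} (X : Set (Seq M)) (h : ℝ) : Prop :=
  Tendsto (fun m : ℕ => Real.log ((prefixes m X).ncard : ℝ) / (m : ℝ)) atTop (𝓝 h)

/-- The expansions of `1` in base `q` that do not end with `0^∞`. -/
def infiniteExpansionsOfOne (M : ℕ) (q : ℝ) : Set (Seq M) :=
  {x | value M q x = 1 ∧ ∀ N : ℕ, ∃ i, N ≤ i ∧ x i ≠ 0}

/-- `x` is the quasi-greedy expansion of `1` in base `q`: the lexicographically largest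
expansion of `1` not ending with `0^∞`. -/
def IsQuasiGreedy (M : ℕ) (q : ℝ) (x : Seq M) : Prop :=
  x ∈ infiniteExpansionsOfOne M q ∧
    ∀ y ∈ infiniteExpansionsOfOne M q, toLex y ≤ toLex x

/-- The Thue–Morse sequence: the parity of the binary digit sum of `i`. -/
def thueMorse (i : ℕ) : ℕ := (Nat.digits 2 i).sum % 2

/-- The sequence `λ_i` for `i ≥ 1`: it is `k + τ_i - τ_{i-1}` if `M = 2k`, and `k + τ_i`
if `M = 2k + 1`. -/
def lam (M i : ℕ) : ℤ :=
  if Even M then ((M / 2 : ℕ) : ℤ) + (thueMorse i : ℤ) - (thueMorse (i - 1) : ℤ)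
  else ((M / 2 : ℕ) : ℤ) + (thueMorse i : ℤ)

/-- The length of the block `λ_1 … λ_L` from which the `n`-th base is built. -/
def blockLength (M n : ℕ) : ℕ := if Even M then 2 ^ (n - 1) else 2 ^ n

/-- The digits of the eventually periodic sequence `w (w̄⁺)^∞`, where `w = λ_1 … λ_L` and `w̄⁺` is
the reflection of `w` with its last digit increased by one. -/
def baseDigit (M n i : ℕ) : ℤ :=
  if i < blockLength M n then lam M (i + 1)
  else
    let j := (i - blockLength M n) % blockLength M n
    (M : ℤ) - lam M (j + 1) + (if j + 1 = blockLength M n then 1 else 0)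

/-- `q` is the base `q'_n`, i.e. `q ∈ (1, M + 1]` and the quasi-greedy expansion of `1` in
base `q` is `w (w̄⁺)^∞`. -/
def IsSpecialBase (M n : ℕ) (q : ℝ) : Prop :=
  q ∈ Set.Ioc (1 : ℝ) ((M : ℝ) + 1) ∧
    ∃ x : Seq M, IsQuasiGreedy M q x ∧ ∀ i, ((x i : ℕ) : ℤ) = baseDigit M n i

/-- The transitive base `q_T = q'_1`. -/
def IsTransitiveBase (M : ℕ) (q : ℝ) : Prop := IsSpecialBase M 1 q

/-- The constant `c_M`: it is `1` for even `M` and `1/2` for odd `M`. -/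
def entropyConst (M : ℕ) : ℝ := if Even M then 1 else 1 / 2

end NonIntegerBase

end

/-! Let a be the prescribed expansion of 1 in base q_n'. A sequence is the only expansion of its
value exactly when each of its tails following a digit below M is lexicographically smaller than a,
and the same holds for its reflection (`greedyCondition_of_mem`,
`mem_symbolicUnivoqueSet_of_greedyCondition`). This a comes from a binary sequence: `bound J` is the
image of 01^∞ under J Thue–Morse substitutions, with 2^J = L, and `coding` reads consecutive states
as one digit (`coding_bound_eq_baseDigit`). Coding respects the order between sequences with the
same first state and turns complements into reflections, so the problem becomes binary.

Upper bound: a nonconstant univoque sequence is a constant word, one digit, and the coding of a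
binary sequence satisfying the level-J condition (`InWindow.exists_coding`). A sequence of level J+1
is constant, or a constant word followed by the substituted image of a sequence of level J
(`LevelCondition.exists_subst`, `LevelCondition.of_subst`). Each level halves the number of free
letters at the cost of a linear factor, which leaves polynomially many times 2^(m/2^J) prefixes.

Lower bound: if both letters occur infinitely often in e, then `coding M (subst^[J] e)` is univoque
(`coding_iterate_subst_mem`), which gives 2^⌊m/2^J⌋ prefixes. The entropy is therefore log 2 / 2^J.
-/

namespace NonIntegerBase

/-! ### Shifts, lexicographic order and reflection -/

/-- The sequence with its first `n` terms removed. -/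
def shift {A : Type*} (n : ℕ) (x : ℕ → A) : ℕ → A := fun i => x (i + n)

@[simp] lemma shift_apply {A : Type*} (n : ℕ) (x : ℕ → A) (i : ℕ) : shift n x i = x (i + n) := rfl

@[simp] lemma shift_zero {A : Type*} (x : ℕ → A) : shift 0 x = x := rfl

lemma shift_shift {A : Type*} (m n : ℕ) (x : ℕ → A) : shift m (shift n x) = shift (m + n) x := by
  funext i
  simp [add_assoc]

lemma lex_lt_iff {A : Type*} [LinearOrder A] {x y : ℕ → A} :
    toLex x < toLex y ↔ ∃ m, (∀ i < m, x i = y i) ∧ x m < y m := Iff.rfl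

/-- The reflection of a sequence of digits. -/
def reflect {M : ℕ} (x : Seq M) : Seq M := fun i => Fin.rev (x i)

@[simp] lemma reflect_apply {M : ℕ} (x : Seq M) (i : ℕ) : reflect x i = Fin.rev (x i) := rfl

@[simp] lemma reflect_reflect {M : ℕ} (x : Seq M) : reflect (reflect x) = x := by
  funext i
  simp

lemma shift_reflect {M : ℕ} (n : ℕ) (x : Seq M) : shift n (reflect x) = reflect (shift n x) := rfl

lemma reflect_val {M : ℕ} (x : Seq M) (i : ℕ) :
    ((reflect x i : ℕ) : ℝ) = (M : ℝ) - (x i : ℕ) := by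
  have h := (x i).is_le
  rw [reflect_apply, Fin.val_rev, show M + 1 - ((x i : ℕ) + 1) = M - (x i : ℕ) by omega,
    Nat.cast_sub h]

/-! ### Expansions in base q and the lexicographic criterion for uniqueness -/

section Value

variable {M : ℕ} {q : ℝ}

lemma digit_le (x : Seq M) (i : ℕ) : ((x i : ℕ) : ℝ) ≤ M := by
  exact_mod_cast (x i).is_le

lemma summable_pow_inv (hq : 1 < q) (C : ℝ) : Summable fun i : ℕ => C / q ^ (i + 1) := by
  have h : Summable fun i : ℕ => (q⁻¹) ^ i :=
    summable_geometric_of_lt_one (by positivity) (inv_lt_one_of_one_lt₀ hq)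
  refine ((h.mul_left (C * q⁻¹))).congr fun i => ?_
  rw [pow_succ, inv_pow]
  field_simp

lemma summable_value (hq : 1 < q) (x : Seq M) :
    Summable fun i : ℕ => ((x i : ℕ) : ℝ) / q ^ (i + 1) := by
  refine Summable.of_nonneg_of_le (fun i => by positivity) (fun i => ?_)
    (summable_pow_inv hq (M : ℝ))
  have := digit_le x i
  gcongr

lemma value_nonneg (hq : 1 < q) (x : Seq M) : 0 ≤ value M q x :=
  tsum_nonneg fun i => by positivity

lemma value_cons (hq : 1 < q) (x : Seq M) :
    value M q x = ((x 0 : ℕ) + value M q (shift 1 x)) / q := by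
  have hq0 : q ≠ 0 := by positivity
  rw [value, (summable_value hq x).tsum_eq_zero_add, add_div, value, ← tsum_div_const]
  congr 1
  · simp
  · refine tsum_congr fun i => ?_
    rw [shift_apply, pow_succ q (i + 1)]
    field_simp

lemma value_const_last (hq : 1 < q) : value M q (fun _ => Fin.last M) = M / (q - 1) := by
  have h := value_cons hq (fun _ => Fin.last M : Seq M)
  have hs : shift 1 (fun _ => Fin.last M : Seq M) = fun _ => Fin.last M := rfl
  have h1 : q - 1 ≠ 0 := by linarith
  have h0 : q ≠ 0 := by linarith
  rw [hs] at h
  simp only [Fin.val_last] at h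
  field_simp at h ⊢
  linarith

lemma value_reflect (hq : 1 < q) (x : Seq M) :
    value M q (reflect x) = M / (q - 1) - value M q x := by
  rw [eq_sub_iff_add_eq, ← value_const_last hq, value, value, value,
    ← (summable_value hq _).tsum_add (summable_value hq _)]
  refine tsum_congr fun i => ?_
  rw [reflect_val, Fin.val_last]
  ring

lemma value_le (hq : 1 < q) (x : Seq M) : value M q x ≤ M / (q - 1) := by
  have h := value_nonneg hq (reflect x)
  rw [value_reflect hq] at h
  linarith

lemma value_sub_of_agree (hq : 1 < q) {m : ℕ} : ∀ {x y : Seq M}, (∀ i < m, x i = y i) →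
    value M q x - value M q y = (value M q (shift m x) - value M q (shift m y)) / q ^ m := by
  have hq0 : q ≠ 0 := by positivity
  induction m with
  | zero => intro x y _; simp
  | succ m ih =>
    intro x y h
    have h1 := ih (x := shift 1 x) (y := shift 1 y) fun i hi => h (i + 1) (by omega)
    rw [shift_shift, shift_shift] at h1
    rw [value_cons hq x, value_cons hq y, h 0 (by omega), ← sub_div, add_sub_add_left_eq_sub, h1,
      pow_succ, div_div]

lemma value_sub_of_agree' (hq : 1 < q) {m : ℕ} {x y : Seq M} (h : ∀ i < m, x i = y i) :
    value M q x - value M q y = (((x m : ℕ) : ℝ) - (y m : ℕ) + value M q (shift (m + 1) x)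
      - value M q (shift (m + 1) y)) / q ^ (m + 1) := by
  have hq0 : q ≠ 0 := by positivity
  rw [value_sub_of_agree hq h, value_cons hq (shift m x), value_cons hq (shift m y),
    shift_shift, shift_shift, add_comm 1 m, pow_succ]
  simp only [shift_apply, zero_add]
  field_simp
  ring

lemma value_pos (hq : 1 < q) {x : Seq M} {i : ℕ} (hi : x i ≠ 0) : 0 < value M q x := by
  refine (summable_value hq x).tsum_pos (fun i => by positivity) i ?_
  have : 0 < ((x i : ℕ) : ℝ) := by
    have h : (x i : ℕ) ≠ 0 := fun h => hi (Fin.ext h)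
    positivity
  positivity

/-- Every number of `[0, M / (q - 1)]` has an expansion in base `q ∈ (1, M + 1]`. -/
lemma exists_value_eq (hq : 1 < q) (hqM : q ≤ M + 1) {t : ℝ} (h0 : 0 ≤ t)
    (h1 : t ≤ M / (q - 1)) : ∃ x : Seq M, value M q x = t := by
  have hq0 : 0 < q := by linarith
  have hq1 : 0 < q - 1 := by linarith
  have hone : 1 ≤ (M : ℝ) / (q - 1) := by rw [le_div_iff₀ hq1]; linarith
  -- The greedy digit min(⌊qs⌋, M). When ⌊qs⌋ ≤ M the remainder is below 1, and 1 ≤ M/(q-1) because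
  -- q ≤ M + 1.
  have step : ∀ s : Set.Icc (0 : ℝ) (M / (q - 1)), ∃ d : Fin (M + 1),
      q * s - (d : ℕ) ∈ Set.Icc (0 : ℝ) (M / (q - 1)) := by
    rintro ⟨s, hs0, hs1⟩
    have hqs : 0 ≤ q * s := by positivity
    rcases le_or_gt (⌊q * s⌋₊) M with h | h
    · refine ⟨⟨⌊q * s⌋₊, by omega⟩, ?_, ?_⟩
      · simpa using Nat.floor_le hqs
      · have := Nat.lt_floor_add_one (q * s)
        simp only
        linarith
    · refine ⟨Fin.last M, ?_, ?_⟩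
      · have h2 : (M : ℝ) ≤ ⌊q * s⌋₊ := by exact_mod_cast h.le
        have := Nat.floor_le hqs
        simp only [Fin.val_last]
        linarith
      · simp only [Fin.val_last]
        rw [le_div_iff₀ hq1] at hs1 ⊢
        nlinarith
  choose d hd using step
  let r : ℕ → Set.Icc (0 : ℝ) (M / (q - 1)) :=
    fun n => Nat.rec ⟨t, h0, h1⟩ (fun _ s => ⟨q * s - (d s : ℕ), hd s⟩) n
  have hr : ∀ n, (r (n + 1)).1 = q * (r n).1 - (d (r n) : ℕ) := fun _ => rfl
  refine ⟨fun n => d (r n), HasSum.tsum_eq ?_⟩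
  have hpart : ∀ n, ∑ i ∈ Finset.range n, ((d (r i) : ℕ) : ℝ) / q ^ (i + 1)
      = t - (r n).1 / q ^ n := by
    intro n
    induction n with
    | zero => simp [r]
    | succ n ih =>
      rw [Finset.sum_range_succ, ih, hr, pow_succ]
      field_simp
      ring
  rw [hasSum_iff_tendsto_nat_of_nonneg (fun i => by positivity)]
  simp only [hpart]
  have hlim : Tendsto (fun n => (r n).1 / q ^ n) atTop (𝓝 0) := by
    have hz : Tendsto (fun n : ℕ => (M / (q - 1)) / q ^ n) atTop (𝓝 0) :=
      tendsto_const_nhds.div_atTop (tendsto_pow_atTop_atTop_of_one_lt hq)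
    refine squeeze_zero (fun n => div_nonneg (r n).2.1 (by positivity)) (fun n => ?_) hz
    have := (r n).2.2
    gcongr
  simpa using hlim.const_sub t

lemma mem_symbolicUnivoqueSet_iff (hq : 1 < q) {x : Seq M} :
    x ∈ symbolicUnivoqueSet M q ↔ ∀ y, value M q y = value M q x → y = x := by
  constructor
  · rintro ⟨-, z, -, hz⟩ y hy
    rw [hz y hy, hz x rfl]
  · exact fun h => ⟨⟨value_nonneg hq x, value_le hq x⟩, x, rfl, h⟩

lemma reflect_mem_symbolicUnivoqueSet (hq : 1 < q) {x : Seq M}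
    (hx : x ∈ symbolicUnivoqueSet M q) : reflect x ∈ symbolicUnivoqueSet M q := by
  rw [mem_symbolicUnivoqueSet_iff hq] at hx ⊢
  intro y hy
  rw [← reflect_reflect y, hx (reflect y)]
  rw [value_reflect hq, hy, value_reflect hq]
  ring

/-- If every member of `T` equals `a` or falls below `a` at some position after which it stays
in `T`, then the values of the members of `T` do not exceed that of `a`, taken to be `1`. -/
lemma value_le_one_of_lex (hq : 1 < q) {a : Seq M} (ha : value M q a = 1) {T : Set (Seq M)}
    (hT : ∀ z ∈ T, z = a ∨ ∃ m, (∀ i < m, z i = a i) ∧ z m < a m ∧ shift (m + 1) z ∈ T) :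
    ∀ z ∈ T, value M q z ≤ 1 := by
  have hq0 : 0 < q := by linarith
  set B : ℝ := M / (q - 1)
  have hB : 0 ≤ B := div_nonneg (Nat.cast_nonneg _) (by linarith)
  -- Losing a digit to a costs at least 1, so the excess over 1 of z is at most that of its tail
  -- divided by q^(m+1). Iterating drives the bound to 0.
  have key : ∀ n : ℕ, ∀ z ∈ T, value M q z - 1 ≤ B / q ^ n := by
    intro n
    induction n with
    | zero => intro z _; have := value_le hq z; simp; linarith
    | succ n ih =>
      intro z hz
      rcases hT z hz with rfl | ⟨m, hag, hlt, hm⟩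
      · rw [ha, sub_self]; positivity
      · have h1 := value_sub_of_agree' hq hag
        have h2 : ((z m : ℕ) : ℝ) + 1 ≤ (a m : ℕ) := by exact_mod_cast hlt
        have h3 := value_nonneg hq (shift (m + 1) a)
        have h4 := ih _ hm
        rw [ha] at h1
        rw [h1]
        have h5 : q ≤ q ^ (m + 1) := le_self_pow₀ hq.le (by omega)
        calc _ ≤ B / q ^ n / q ^ (m + 1) := by gcongr; linarith
          _ ≤ B / q ^ n / q := by gcongr
          _ = _ := by rw [pow_succ, div_div]
  intro z hz
  have hlim : Tendsto (fun n : ℕ => B / q ^ n) atTop (𝓝 0) :=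
    tendsto_const_nhds.div_atTop (tendsto_pow_atTop_atTop_of_one_lt hq)
  have := ge_of_tendsto' hlim fun n => key n z hz
  linarith

/-- The digit lost at m already balances a tail of value at most 1; strictness comes from the tail
of a, which is positive because a does not end in zeros. -/
lemma value_lt_one_of_lex (hq : 1 < q) {a : Seq M} (ha : value M q a = 1)
    (hinf : ∀ N : ℕ, ∃ i, N ≤ i ∧ a i ≠ 0) {z : Seq M} {m : ℕ} (hag : ∀ i < m, z i = a i)
    (hlt : z m < a m) (hv : value M q (shift (m + 1) z) ≤ 1) : value M q z < 1 := by
  have hq0 : 0 < q := by linarith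
  have h1 := value_sub_of_agree' hq hag
  have h2 : ((z m : ℕ) : ℝ) + 1 ≤ (a m : ℕ) := by exact_mod_cast hlt
  obtain ⟨i, hi, hai⟩ := hinf (m + 1)
  have h3 : 0 < value M q (shift (m + 1) a) :=
    value_pos hq (i := i - (m + 1)) (by rwa [shift_apply, Nat.sub_add_cancel hi])
  have h4 : value M q z - value M q a < 0 := by
    rw [h1]
    exact div_neg_of_neg_of_pos (by linarith) (by positivity)
  linarith

lemma value_shift_le_one (hq : 1 < q) {a : Seq M} (ha : value M q a = 1)
    (hs : ∀ n, toLex (shift n a) ≤ toLex a) (n : ℕ) : value M q (shift n a) ≤ 1 := by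
  refine value_le_one_of_lex hq ha (T := Set.range fun n => shift n a) ?_ _ ⟨n, rfl⟩
  rintro _ ⟨n, rfl⟩
  rcases (hs n).eq_or_lt with h | h
  · exact Or.inl h
  · obtain ⟨m, h1, h2⟩ := lex_lt_iff.1 h
    exact Or.inr ⟨m, h1, h2, m + 1 + n, (shift_shift _ _ _).symm⟩

lemma one_le_value_of_lex_le (hq : 1 < q) {a : Seq M} (ha : value M q a = 1)
    (hs : ∀ n, toLex (shift n a) ≤ toLex a) {y : Seq M} (h : toLex a ≤ toLex y) :
    1 ≤ value M q y := by
  have hq0 : 0 < q := by linarith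
  rcases h.eq_or_lt with h | h
  · have h : a = y := h
    rw [← h, ha]
  · obtain ⟨m, h1, h2⟩ := lex_lt_iff.1 h
    have h3 := value_sub_of_agree' hq h1
    have h4 : ((a m : ℕ) : ℝ) + 1 ≤ (y m : ℕ) := by exact_mod_cast h2
    have h5 := value_shift_le_one hq ha hs (m + 1)
    have h6 := value_nonneg hq (shift (m + 1) y)
    have h7 : value M q a - value M q y ≤ 0 := by
      rw [h3]
      exact div_nonpos_of_nonpos_of_nonneg (by linarith) (by positivity)
    linarith

/-- A larger infinite expansion y of 1 could take the role of the bound in `value_lt_one_of_lex`,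
forcing the value of a below 1. -/
lemma isQuasiGreedy_of_lex (hq : 1 < q) {a : Seq M} (ha : value M q a = 1)
    (hs : ∀ n, toLex (shift n a) ≤ toLex a) (hinf : ∀ N : ℕ, ∃ i, N ≤ i ∧ a i ≠ 0) :
    IsQuasiGreedy M q a := by
  refine ⟨⟨ha, hinf⟩, fun y hy => ?_⟩
  by_contra! h
  obtain ⟨m, h1, h2⟩ := lex_lt_iff.1 h
  have := value_lt_one_of_lex hq hy.1 hy.2 h1 h2 (value_shift_le_one hq ha hs (m + 1))
  linarith

/-- The lexicographic condition satisfied by greedy expansions. -/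
def GreedyCondition (a x : Seq M) : Prop :=
  ∀ i, x i ≠ Fin.last M → toLex (shift (i + 1) x) < toLex a

/-- A tail that is lexicographically at least a is worth at least 1. The preceding digit could then
be raised by one and the tail replaced by an expansion of its value minus 1, giving a second
expansion. -/
lemma greedyCondition_of_mem (hq : 1 < q) (hqM : q ≤ M + 1) {a : Seq M} (ha : value M q a = 1)
    (hs : ∀ n, toLex (shift n a) ≤ toLex a) {x : Seq M} (hx : x ∈ symbolicUnivoqueSet M q) :
    GreedyCondition a x := by
  intro i hi
  by_contra h
  replace h := not_lt.1 h
  have hq0 : q ≠ 0 := by positivity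
  have h1 := one_le_value_of_lex_le hq ha hs h
  have h2 := value_le hq (shift (i + 1) x)
  obtain ⟨t, ht⟩ := exists_value_eq hq hqM (t := value M q (shift (i + 1) x) - 1)
    (by linarith) (by linarith)
  have hlt : (x i : ℕ) < M := Fin.val_lt_last hi
  let y : Seq M := fun j => if j < i then x j else if j = i then ⟨x i + 1, by omega⟩
    else t (j - (i + 1))
  have hy1 : ∀ j < i, y j = x j := fun j hj => by simp [y, hj]
  have hy2 : (y i : ℕ) = x i + 1 := by simp [y]
  have hy3 : shift (i + 1) y = t := by
    funext j
    simp only [shift_apply, y]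
    rw [if_neg (by omega), if_neg (by omega), Nat.add_sub_cancel]
  have h3 := value_sub_of_agree' hq hy1
  rw [hy2, hy3, ht] at h3
  have h4 : value M q y = value M q x := by
    rw [← sub_eq_zero, h3]
    push_cast
    ring_nf
  have h5 := (mem_symbolicUnivoqueSet_iff hq).1 hx y h4
  rw [h5] at hy2
  omega

lemma value_shift_lt_one_of_greedyCondition (hq : 1 < q) {a : Seq M} (ha : value M q a = 1)
    (hinf : ∀ N : ℕ, ∃ i, N ≤ i ∧ a i ≠ 0) {x : Seq M} (hx : GreedyCondition a x) {i : ℕ}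
    (hi : x i ≠ Fin.last M) : value M q (shift (i + 1) x) < 1 := by
  -- At the first difference the digit of x is below one of a, hence below M, so the condition
  -- applies again from there.
  have aux : ∀ i, x i ≠ Fin.last M → ∃ m, (∀ j < m, shift (i + 1) x j = a j) ∧
      shift (i + 1) x m < a m ∧ x (m + (i + 1)) ≠ Fin.last M := by
    intro i hi
    obtain ⟨m, h1, h2⟩ := lex_lt_iff.1 (hx i hi)
    exact ⟨m, h1, h2, (h2.trans_le (Fin.le_last _)).ne⟩
  have hle := value_le_one_of_lex hq ha
    (T := {z | ∃ i, x i ≠ Fin.last M ∧ z = shift (i + 1) x}) (by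
      rintro _ ⟨i, hi, rfl⟩
      obtain ⟨m, h1, h2, h3⟩ := aux i hi
      refine Or.inr ⟨m, h1, h2, m + (i + 1), h3, ?_⟩
      rw [shift_shift]
      congr 1
      ring)
  obtain ⟨m, h1, h2, h3⟩ := aux i hi
  refine value_lt_one_of_lex hq ha hinf h1 h2 (hle _ ⟨m + (i + 1), h3, ?_⟩)
  rw [shift_shift]
  congr 1
  ring

/-- Sequences satisfying the lexicographic conditions are unique expansions. -/
lemma mem_symbolicUnivoqueSet_of_greedyCondition (hq : 1 < q) {a : Seq M}
    (ha : value M q a = 1) (hinf : ∀ N : ℕ, ∃ i, N ≤ i ∧ a i ≠ 0) {x : Seq M}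
    (hx : GreedyCondition a x) (hx' : GreedyCondition a (reflect x)) :
    x ∈ symbolicUnivoqueSet M q := by
  have hq0 : 0 < q := by linarith
  -- A lexicographically larger y gains at least one unit where a tail of x worth less than 1
  -- begins. Smaller competitors are excluded by reflecting.
  have main : ∀ x y : Seq M, GreedyCondition a x → value M q y = value M q x →
      ¬ toLex x < toLex y := by
    intro x y hx hy h
    obtain ⟨m, h1, h2⟩ := lex_lt_iff.1 h
    have h3 := value_shift_lt_one_of_greedyCondition hq ha hinf hx
      (i := m) (h2.trans_le (Fin.le_last _)).ne
    have h4 := value_sub_of_agree' hq h1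
    have h5 : ((x m : ℕ) : ℝ) + 1 ≤ (y m : ℕ) := by exact_mod_cast h2
    have h6 := value_nonneg hq (shift (m + 1) y)
    have h7 : value M q x - value M q y < 0 := by
      rw [h4]
      exact div_neg_of_neg_of_pos (by linarith) (by positivity)
    linarith
  rw [mem_symbolicUnivoqueSet_iff hq]
  intro y hy
  rcases lt_trichotomy (toLex x) (toLex y) with h | h | h
  · exact (main x y hx hy h).elim
  · exact h.symm
  · refine (main (reflect x) (reflect y) hx' (by rw [value_reflect hq, value_reflect hq, hy])
      ?_).elim
    obtain ⟨m, h1, h2⟩ := lex_lt_iff.1 h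
    exact ⟨m, fun i hi => by simp [h1 i hi], by simpa using h2⟩

lemma value_lt_of_lt {p : ℝ} (hp : 1 < p) (hpq : p < q) {x : Seq M} (hx : x 0 ≠ 0) :
    value M q x < value M p x := by
  have hx0 : 0 < ((x 0 : ℕ) : ℝ) := by
    have h : (x 0 : ℕ) ≠ 0 := fun h => hx (Fin.ext h)
    positivity
  refine Summable.tsum_lt_tsum (i := 0) (fun i => ?_) ?_ (summable_value (hp.trans hpq) x)
    (summable_value hp x)
  · gcongr
  · simp only [zero_add, pow_one]
    gcongr

/-- Intermediate values: near base 1 the two nonzero digits alone contribute more than 1, while in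
base M + 1 no sequence exceeds 1. -/
lemma exists_base (hM : 1 ≤ M) {a : Seq M} (h0 : a 0 ≠ 0) {j : ℕ} (hj : j ≠ 0) (haj : a j ≠ 0) :
    ∃ q : ℝ, q ∈ Set.Ioc (1 : ℝ) (M + 1) ∧ value M q a = 1 := by
  have hpos : ∀ i, a i ≠ 0 → (1 : ℝ) ≤ (a i : ℕ) := fun i hi => by
    have h : (a i : ℕ) ≠ 0 := fun h => hi (Fin.ext h)
    exact_mod_cast Nat.one_le_iff_ne_zero.2 h
  have hM' : (1 : ℝ) ≤ M := by exact_mod_cast hM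
  obtain ⟨p, hp1, hpM, hp⟩ : ∃ p : ℝ, 1 < p ∧ p < M + 1 ∧ 1 ≤ 1 / p + 1 / p ^ (j + 1) := by
    have hc : ContinuousAt (fun p : ℝ => 1 / p + 1 / p ^ (j + 1)) 1 := by
      refine ContinuousAt.add ?_ ?_
      · exact continuousAt_const.div continuousAt_id (by norm_num)
      · exact continuousAt_const.div (continuousAt_id.pow _) (by norm_num)
    have h1 : ∀ᶠ p in 𝓝[>] (1 : ℝ), 1 < 1 / p + 1 / p ^ (j + 1) :=
      (hc.eventually (lt_mem_nhds (by norm_num))).filter_mono nhdsWithin_le_nhds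
    have h2 : ∀ᶠ p in 𝓝[>] (1 : ℝ), p ∈ Set.Ioo (1 : ℝ) (M + 1) :=
      Ioo_mem_nhdsGT (by linarith)
    obtain ⟨p, hp, hp'⟩ := (h1.and h2).exists
    exact ⟨p, hp'.1, hp'.2, hp.le⟩
  have hcont : ContinuousOn (fun q => value M q a) (Set.Icc p (M + 1)) := by
    refine continuousOn_tsum (u := fun i : ℕ => (M : ℝ) / p ^ (i + 1)) (fun i => ?_)
      (summable_pow_inv hp1 _) fun i x hx => ?_
    · refine continuousOn_const.div (continuousOn_id.pow _) fun x hx => ?_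
      have : 0 < x := by linarith [hx.1]
      positivity
    · have hxp : p ≤ x := hx.1
      have : 0 < x := by linarith
      have := digit_le a i
      rw [Real.norm_of_nonneg (by positivity)]
      gcongr
  have hlow : 1 ≤ value M p a := by
    have h1 := (summable_value hp1 a).sum_le_tsum {0, j} fun i _ => by positivity
    rw [Finset.sum_pair hj.symm, zero_add, pow_one] at h1
    refine hp.trans (le_trans ?_ h1)
    have := hpos 0 h0
    have := hpos j haj
    gcongr
  have hup : value M (M + 1) a ≤ 1 := by
    have h1 := value_le (by linarith : (1 : ℝ) < M + 1) a
    rwa [add_sub_cancel_right, div_self (by linarith)] at h1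
  obtain ⟨q, hq, hv⟩ := intermediate_value_Icc' hpM.le hcont ⟨hup, hlow⟩
  exact ⟨q, ⟨hp1.trans_le hq.1, hq.2⟩, hv⟩

end Value

/-! ### The Thue–Morse substitution and its extremal sequences -/

/-- The complement of a binary sequence. -/
def neg (c : ℕ → Bool) : ℕ → Bool := fun i => !c i

@[simp] lemma neg_apply (c : ℕ → Bool) (i : ℕ) : neg c i = !c i := rfl

/-- The Thue–Morse substitution `0 ↦ 01`, `1 ↦ 10`. -/
def subst (c : ℕ → Bool) : ℕ → Bool := fun i => xor (c (i / 2)) (decide (i % 2 = 1))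

lemma subst_even (c : ℕ → Bool) (i : ℕ) : subst c (2 * i) = c i := by
  simp [subst]

lemma subst_odd (c : ℕ → Bool) (i : ℕ) : subst c (2 * i + 1) = !c i := by
  rw [subst, show (2 * i + 1) / 2 = i by omega, show (2 * i + 1) % 2 = 1 by omega]
  simp

lemma subst_neg (c : ℕ → Bool) : subst (neg c) = neg (subst c) := by
  funext i
  simp [subst]

lemma shift_subst (c : ℕ → Bool) (l : ℕ) : shift (2 * l) (subst c) = subst (shift l c) := by
  funext i
  simp only [shift_apply, subst]
  congr 2
  · omega
  · simp

lemma iterate_subst_neg (J : ℕ) (c : ℕ → Bool) : subst^[J] (neg c) = neg (subst^[J] c) := by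
  induction J generalizing c with
  | zero => rfl
  | succ J ih => rw [Function.iterate_succ_apply, subst_neg, ih, Function.iterate_succ_apply]

lemma subst_lt {c d : ℕ → Bool} (h : toLex c < toLex d) : toLex (subst c) < toLex (subst d) := by
  obtain ⟨m, h1, h2⟩ := lex_lt_iff.1 h
  refine lex_lt_iff.2 ⟨2 * m, fun i hi => ?_, ?_⟩
  · rw [subst, subst, h1 _ (by omega)]
  · rwa [subst_even, subst_even]

lemma subst_le_iff {c d : ℕ → Bool} :
    toLex (subst c) ≤ toLex (subst d) ↔ toLex c ≤ toLex d := by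
  constructor
  · intro h
    by_contra h'
    exact absurd h (not_le.2 (subst_lt (not_le.1 h')))
  · intro h
    rcases h.eq_or_lt with h | h
    · rw [show c = d from h]
    · exact (subst_lt h).le

/-- The image of `0 1^∞` under the `J`-th iterate of the Thue–Morse substitution. -/
def bound (J : ℕ) : ℕ → Bool := subst^[J] fun i => decide (i ≠ 0)

lemma bound_succ (J : ℕ) : bound (J + 1) = subst (bound J) := Function.iterate_succ_apply' _ _ _

lemma bound_at_zero (J : ℕ) : bound J 0 = false := by
  induction J with
  | zero => rfl
  | succ J ih => rw [bound_succ]; exact (subst_even _ 0).trans ih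

lemma bound_at_one (J : ℕ) : bound J 1 = true := by
  cases J with
  | zero => rfl
  | succ J => rw [bound_succ]; exact (subst_odd _ 0).trans (by rw [bound_at_zero]; rfl)

lemma bound_at_two (J : ℕ) : bound (J + 1) 2 = true := by
  rw [bound_succ]
  exact (subst_even _ 1).trans (bound_at_one J)

/-- From an odd position one reads 0 followed by a complete pair 01 or 10, hence 001 or 010, whereas
`subst b` starts with 011. -/
lemma shift_subst_lt_of_odd {c b : ℕ → Bool} (h0 : b 0 = false) (h1 : b 1 = true) {l : ℕ}
    (hl : subst c (2 * l + 1) = false) :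
    toLex (shift (2 * l + 1) (subst c)) < toLex (subst b) := by
  have b0 : subst b 0 = false := (subst_even b 0).trans h0
  have b1 : subst b 1 = true := (subst_odd b 0).trans (by rw [h0]; rfl)
  have b2 : subst b 2 = true := (subst_even b 1).trans h1
  have e1 : shift (2 * l + 1) (subst c) 1 = c (l + 1) := by
    rw [← subst_even c, shift_apply]; congr 1; ring
  have e2 : shift (2 * l + 1) (subst c) 2 = !c (l + 1) := by
    rw [← subst_odd c, shift_apply]; congr 1; ring
  cases hc : c (l + 1)
  · refine lex_lt_iff.2 ⟨1, fun i hi => ?_, ?_⟩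
    · obtain rfl : i = 0 := by omega
      rw [shift_apply, zero_add, hl]
      exact b0.symm
    · rw [e1, hc, b1]
      decide
  · refine lex_lt_iff.2 ⟨2, fun i hi => ?_, ?_⟩
    · obtain rfl | rfl : i = 0 ∨ i = 1 := by omega
      · rw [shift_apply, zero_add, hl]
        exact b0.symm
      · rw [e1, hc, b1]
    · rw [e2, hc, b2]
      decide

/-- At level 0, 01^∞ is the largest sequence starting with 0. At each further level even positions
inherit the inequality by monotonicity, and odd positions satisfy it automatically. -/
lemma shift_iterate_subst_le (J : ℕ) (e : ℕ → Bool) {i : ℕ} (hi : subst^[J] e i = false) :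
    toLex (shift i (subst^[J] e)) ≤ toLex (bound J) := by
  induction J generalizing i with
  | zero =>
    by_contra h
    obtain ⟨m, h1, h2⟩ := lex_lt_iff.1 (not_le.1 h)
    rcases Nat.eq_zero_or_pos m with rfl | hm
    · rw [shift_apply, zero_add, hi] at h2
      exact absurd h2 (by simp)
    · have : bound 0 m = true := by simp [bound, hm.ne']
      rw [this] at h2
      exact absurd h2 (by simp)
  | succ J ih =>
    rw [Function.iterate_succ_apply'] at hi ⊢
    rw [bound_succ]
    obtain ⟨l, rfl | rfl⟩ := i.even_or_odd'
    · rw [shift_subst, subst_le_iff]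
      exact ih (by rwa [subst_even] at hi)
    · exact (shift_subst_lt_of_odd (bound_at_zero J) (bound_at_one J) hi).le

lemma shift_iterate_subst_lt (J : ℕ) {e : ℕ → Bool} (he : ∀ N, ∃ i, N ≤ i ∧ e i = false) {i : ℕ}
    (hi : subst^[J] e i = false) : toLex (shift i (subst^[J] e)) < toLex (bound J) := by
  induction J generalizing i with
  | zero =>
    refine (shift_iterate_subst_le 0 e hi).lt_of_ne fun h => ?_
    obtain ⟨j, hj, hej⟩ := he (i + 1)
    have h1 := congrFun (show shift i e = bound 0 from h) (j - i)
    rw [shift_apply, Nat.sub_add_cancel (by omega), hej] at h1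
    simp [bound] at h1
    omega
  | succ J ih =>
    rw [Function.iterate_succ_apply'] at hi ⊢
    rw [bound_succ]
    obtain ⟨l, rfl | rfl⟩ := i.even_or_odd'
    · rw [shift_subst]
      exact subst_lt (ih (by rwa [subst_even] at hi))
    · exact shift_subst_lt_of_odd (bound_at_zero J) (bound_at_one J) hi

/-! ### Level conditions and renormalisation -/

/-- The lexicographic conditions of level `J` on binary sequences. -/
def LevelCondition (J : ℕ) (c : ℕ → Bool) : Prop :=
  ∀ i, (c i = false → toLex (shift i c) ≤ toLex (bound J)) ∧
    (c i = true → toLex (shift i (neg c)) ≤ toLex (bound J))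

lemma bound_le_bound_one (J : ℕ) : toLex (bound (J + 1)) ≤ toLex (bound 1) := by
  rw [bound_succ J, bound_succ 0, subst_le_iff]
  exact shift_iterate_subst_le 0 (bound J) (i := 0) (bound_at_zero J)

lemma LevelCondition.one {J : ℕ} {c : ℕ → Bool} (h : LevelCondition (J + 1) c) :
    LevelCondition 1 c := fun i =>
  ⟨fun hi => ((h i).1 hi).trans (bound_le_bound_one J),
    fun hi => ((h i).2 hi).trans (bound_le_bound_one J)⟩

/-- Normalised to start with 0, a tail can leave the bound only downwards, so there is no choice
where the bound has a 0. -/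
lemma LevelCondition.next {J : ℕ} {c : ℕ → Bool} (h : LevelCondition J c) {p n : ℕ}
    (hag : ∀ i < n, c (p + i) = xor (c p) (bound J i)) (hn : bound J n = false) :
    c (p + n) = c p := by
  have aux : ∀ c : ℕ → Bool, toLex (shift p c) ≤ toLex (bound J) →
      (∀ i < n, c (p + i) = bound J i) → c (p + n) = false := by
    intro c hc hag
    by_contra h'
    refine absurd hc (not_le.2 (lex_lt_iff.2 ⟨n, fun i hi => ?_, ?_⟩))
    · rw [shift_apply, add_comm, hag i hi]
    · rw [shift_apply, hn, add_comm, eq_true_of_ne_false h']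
      decide
  cases hp : c p
  · exact aux c ((h p).1 hp) fun i hi => by rw [hag i hi, hp, Bool.false_xor]
  · have := aux (neg c) ((h p).2 hp) fun i hi => by
      rw [neg_apply, hag i hi, hp, Bool.true_xor, Bool.not_not]
    simpa using this

lemma bound_one_odd (s : ℕ) : bound 1 (2 * s + 3) = false := by
  rw [bound_succ 0, show 2 * s + 3 = 2 * (s + 1) + 1 by ring, subst_odd]
  simp [bound]

lemma bound_one_even (s : ℕ) : bound 1 (2 * s + 2) = true := by
  rw [bound_succ 0, show 2 * s + 2 = 2 * (s + 1) by ring, subst_even]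
  simp [bound]

lemma LevelCondition.ne_of_repeat {c : ℕ → Bool} (h : LevelCondition 1 c) {r : ℕ}
    (h1 : c r ≠ c (r + 1)) (h2 : c (r + 1) = c (r + 2)) (l : ℕ) :
    c (r + 2 + 2 * l) ≠ c (r + 3 + 2 * l) := by
  have start : ∀ p, c p ≠ c (p + 1) → c (p + 1) = c (p + 2) →
      ∀ i < 3, c (p + i) = xor (c p) (bound 1 i) := by
    intro p h1 h2 i hi
    obtain rfl | rfl | rfl : i = 0 ∨ i = 1 ∨ i = 2 := by omega
    · rw [bound_at_zero, Bool.xor_false, add_zero]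
    · rw [bound_at_one, Bool.xor_true]
      exact (Bool.eq_not_of_ne h1.symm)
    · rw [bound_at_two, Bool.xor_true, ← h2]
      exact (Bool.eq_not_of_ne h1.symm)
  have extend : ∀ p n, (∀ i < n, c (p + i) = xor (c p) (bound 1 i)) →
      c (p + n) = xor (c p) (bound 1 n) → ∀ i < n + 1, c (p + i) = xor (c p) (bound 1 i) := by
    intro p n h3 h4 i hi
    rcases Nat.lt_succ_iff_lt_or_eq.1 hi with hi | rfl
    · exact h3 i hi
    · exact h4
  -- The tail at p follows `bound 1` = 01(10)^∞, up to complement, through position r + 2l + 2. The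
  -- next letter is forced; the one after it either continues the pattern or creates a new repeat,
  -- and then p restarts at r + 2l + 2.
  have key : ∀ l, ∃ p s, r + 2 * l = p + 2 * s ∧
      ∀ i < 2 * s + 3, c (p + i) = xor (c p) (bound 1 i) := by
    intro l
    induction l with
    | zero => exact ⟨r, 0, by ring, start r h1 h2⟩
    | succ l ih =>
      obtain ⟨p, s, hps, hag⟩ := ih
      have h3 := h.next hag (bound_one_odd s)
      have h4 := hag (2 * s + 2) (by omega)
      rw [bound_one_even, Bool.xor_true] at h4
      by_cases h5 : c (p + (2 * s + 4)) = !c p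
      · refine ⟨p, s + 1, by omega, ?_⟩
        refine extend p (2 * s + 4) (extend p (2 * s + 3) hag ?_) ?_
        · rw [h3, bound_one_odd, Bool.xor_false]
        · rw [h5, show 2 * s + 4 = 2 * (s + 1) + 2 by ring, bound_one_even, Bool.xor_true]
      · refine ⟨r + 2 * l + 2, 0, by omega, start _ ?_ ?_⟩
        · rw [show r + 2 * l + 2 = p + (2 * s + 2) by omega,
            show p + (2 * s + 2) + 1 = p + (2 * s + 3) by omega, h3, h4]
          simp
        · rw [show r + 2 * l + 2 + 1 = p + (2 * s + 3) by omega,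
            show r + 2 * l + 2 + 2 = p + (2 * s + 4) by omega, h3]
          simpa using Bool.eq_not_of_ne h5 |>.symm
  obtain ⟨p, s, hps, hag⟩ := key l
  have h3 := h.next hag (bound_one_odd s)
  have h4 := hag (2 * s + 2) (by omega)
  rw [bound_one_even, Bool.xor_true] at h4
  rw [show r + 2 + 2 * l = p + (2 * s + 2) by omega,
    show r + 3 + 2 * l = p + (2 * s + 3) by omega, h3, h4]
  simp

lemma shift_eq_subst {c : ℕ → Bool} {s : ℕ} (h : ∀ l, c (s + 2 * l) ≠ c (s + 2 * l + 1)) :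
    shift s c = subst fun l => c (s + 2 * l) := by
  funext i
  obtain ⟨l, rfl | rfl⟩ := i.even_or_odd'
  · rw [subst_even, shift_apply, add_comm]
  · rw [subst_odd, shift_apply, ← Bool.eq_not_of_ne (h l).symm]
    congr 1
    ring

/-- A sequence satisfying the conditions of level `1` is constant, or a constant word followed
by an image of the Thue–Morse substitution. -/
lemma LevelCondition.exists_subst {c : ℕ → Bool} (h : LevelCondition 1 c) :
    (∃ a, ∀ i, c i = a) ∨
      ∃ a p c', (∀ i < p, c i = a) ∧ shift p c = subst c' := by
  classical
  by_cases hk : ∃ k, c k ≠ c (k + 1)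
  swap
  · push Not at hk
    refine Or.inl ⟨c 0, fun i => ?_⟩
    induction i with
    | zero => rfl
    | succ i ih => rw [← hk, ih]
  right
  obtain ⟨k, hk, hmin⟩ : ∃ k, c k ≠ c (k + 1) ∧ ∀ j < k, c j = c (j + 1) :=
    ⟨Nat.find hk, Nat.find_spec hk, fun j hj => not_not.1 (Nat.find_min hk hj)⟩
  have hconst : ∀ i ≤ k, c i = c 0 := by
    intro i hi
    induction i with
    | zero => rfl
    | succ i ih => rw [← hmin i (by omega), ih (by omega)]
  suffices hs : ∃ s ≤ k + 1, ∀ l, c (s + 2 * l) ≠ c (s + 2 * l + 1) by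
    obtain ⟨s, hs, hl⟩ := hs
    exact ⟨c 0, s, _, fun i hi => hconst i (by omega), shift_eq_subst hl⟩
  by_cases hr : ∃ r, k ≤ r ∧ c r ≠ c (r + 1) ∧ c (r + 1) = c (r + 2)
  · obtain ⟨r, ⟨hkr, hr1, hr2⟩, hrmin⟩ : ∃ r, (k ≤ r ∧ c r ≠ c (r + 1) ∧ c (r + 1) = c (r + 2)) ∧
        ∀ j < r, ¬ (k ≤ j ∧ c j ≠ c (j + 1) ∧ c (j + 1) = c (j + 2)) :=
      ⟨Nat.find hr, Nat.find_spec hr, fun j hj => Nat.find_min hr hj⟩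
    have halt : ∀ n, k + n ≤ r → c (k + n) ≠ c (k + n + 1) := by
      intro n
      induction n with
      | zero => exact fun _ => hk
      | succ n ih =>
        intro hn h'
        exact hrmin (k + n) (by omega) ⟨by omega, ih (by omega), h'⟩
    -- The pairs must be aligned with the parity of the first repeat r: up to r the sequence
    -- alternates, and from r + 2 on `LevelCondition.ne_of_repeat` applies.
    refine ⟨k + (r - k) % 2, by omega, fun l => ?_⟩
    rcases le_or_gt (k + (r - k) % 2 + 2 * l) r with hl | hl
    · have := halt ((r - k) % 2 + 2 * l) (by omega)
      rwa [← add_assoc] at this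
    · obtain ⟨u, hu⟩ : ∃ u, k + (r - k) % 2 + 2 * l = r + 2 + 2 * u :=
        ⟨(k + (r - k) % 2 + 2 * l - (r + 2)) / 2, by omega⟩
      rw [hu, show r + 2 + 2 * u + 1 = r + 3 + 2 * u by ring]
      exact h.ne_of_repeat hr1 hr2 u
  · push Not at hr
    have halt : ∀ n, c (k + n) ≠ c (k + n + 1) := by
      intro n
      induction n with
      | zero => exact hk
      | succ n ih => exact hr (k + n) (by omega) ih
    exact ⟨k, by omega, fun l => halt _⟩

/-- The binary sequences obtained by alternately applying the Thue–Morse substitution and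
prepending constant words, `J` times. -/
def codes : ℕ → Set (ℕ → Bool)
  | 0 => Set.univ
  | J + 1 => {c | (∃ a, ∀ i, c i = a) ∨
      ∃ a p, ∃ c' ∈ codes J, (∀ i < p, c i = a) ∧ shift p c = subst c'}

lemma codes_nonempty (J : ℕ) : (codes J).Nonempty := by
  cases J with
  | zero => exact ⟨fun _ => false, trivial⟩
  | succ J => exact ⟨fun _ => false, Or.inl ⟨false, fun _ => rfl⟩⟩

/-- Since `bound (J + 1)` is the image of `bound J` and `subst` reflects the order, the conditions
at the positions p + 2l desubstitute. -/
lemma LevelCondition.of_subst {J : ℕ} {c c' : ℕ → Bool} {p : ℕ} (h : LevelCondition (J + 1) c)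
    (hc : shift p c = subst c') : LevelCondition J c' := by
  have aux : ∀ c c' : ℕ → Bool, ∀ l, shift p c = subst c' →
      toLex (shift (2 * l + p) c) ≤ toLex (bound (J + 1)) →
      toLex (shift l c') ≤ toLex (bound J) := by
    intro c c' l hc h
    rwa [← shift_shift, hc, shift_subst, bound_succ, subst_le_iff] at h
  intro l
  have hl : c (2 * l + p) = c' l := by rw [← subst_even c', ← hc, shift_apply]
  refine ⟨fun h0 => aux c c' l hc ((h _).1 (hl.trans h0)),
    fun h0 => aux (neg c) (neg c') l ?_ ((h _).2 (hl.trans h0))⟩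
  rw [subst_neg, ← hc]
  rfl

lemma LevelCondition.mem_codes {J : ℕ} {c : ℕ → Bool} (h : LevelCondition J c) :
    c ∈ codes J := by
  induction J generalizing c with
  | zero => trivial
  | succ J ih =>
    rcases h.one.exists_subst with h1 | ⟨a, p, c', h1, h2⟩
    · exact Or.inl h1
    · exact Or.inr ⟨a, p, c', ih (h.of_subst h2), h1, h2⟩

/-! ### Coding binary sequences by digits -/

/-- The digit produced by moving from state `s` to state `t`. -/
def letter (M : ℕ) (s t : Bool) : Fin (M + 1) :=
  Fin.ofNat (M + 1) (if Even M then M / 2 + t.toNat - s.toNat else M / 2 + t.toNat)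

/-- The sequence of digits read along a sequence of states. -/
def coding (M : ℕ) (c : ℕ → Bool) : Seq M := fun i => letter M (c i) (c (i + 1))

section Coding

variable {M : ℕ}

/-- The value always lies in the alphabet, so the reduction modulo M + 1 built into `letter` is
harmless. -/
lemma letter_val (hM : 1 ≤ M) (s t : Bool) :
    (letter M s t : ℕ) = if Even M then M / 2 + t.toNat - s.toNat else M / 2 + t.toNat := by
  have ht : t.toNat ≤ 1 := Bool.toNat_le t
  rw [letter, Fin.val_ofNat, Nat.mod_eq_of_lt]
  split_ifs with h
  · obtain ⟨k, rfl⟩ := h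
    omega
  · have := Nat.not_even_iff.1 h
    omega

lemma letter_neg (hM : 1 ≤ M) (s t : Bool) : letter M (!s) (!t) = Fin.rev (letter M s t) := by
  apply Fin.ext
  rw [Fin.val_rev, letter_val hM, letter_val hM]
  split_ifs with h
  · obtain ⟨k, rfl⟩ := h
    cases s <;> cases t <;> simp <;> omega
  · have := Nat.not_even_iff.1 h
    cases t <;> simp <;> omega

lemma letter_lt (hM : 1 ≤ M) (s : Bool) {t t' : Bool} (h : t < t') :
    letter M s t < letter M s t' := by
  obtain ⟨rfl, rfl⟩ : t = false ∧ t' = true := by revert h; revert t t'; decide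
  rw [Fin.lt_def, letter_val hM, letter_val hM]
  split_ifs with h
  · obtain ⟨k, rfl⟩ := h
    cases s <;> simp; omega
  · simp

lemma coding_neg (hM : 1 ≤ M) (c : ℕ → Bool) : coding M (neg c) = reflect (coding M c) := by
  funext i
  exact letter_neg hM _ _

lemma shift_coding (n : ℕ) (c : ℕ → Bool) : shift n (coding M c) = coding M (shift n c) := by
  funext i
  simp only [shift_apply, coding]
  congr 2
  ring

/-- For a fixed departure state the digit increases with the arrival state, so a first difference of
states at m + 1 is a first difference of digits at m. -/
lemma coding_lt (hM : 1 ≤ M) {c d : ℕ → Bool} (h0 : c 0 = d 0) (h : toLex c < toLex d) :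
    toLex (coding M c) < toLex (coding M d) := by
  obtain ⟨m, h1, h2⟩ := lex_lt_iff.1 h
  obtain _ | m := m
  · exact absurd h2 (by rw [h0]; exact lt_irrefl _)
  · refine lex_lt_iff.2 ⟨m, fun i hi => ?_, ?_⟩
    · rw [coding, coding, h1 i (by omega), h1 (i + 1) (by omega)]
    · rw [coding, coding, h1 m (by omega)]
      exact letter_lt hM _ h2

lemma coding_le_iff (hM : 1 ≤ M) {c d : ℕ → Bool} (h0 : c 0 = d 0) :
    toLex (coding M c) ≤ toLex (coding M d) ↔ toLex c ≤ toLex d := by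
  constructor
  · intro h
    by_contra h'
    exact absurd h (not_le.2 (coding_lt hM h0.symm (not_le.1 h')))
  · intro h
    rcases h.eq_or_lt with h | h
    · rw [show c = d from h]
    · exact (coding_lt hM h0 h).le

lemma coding_bound_at_zero (hM : 1 ≤ M) (J : ℕ) : (coding M (bound J) 0 : ℕ) = M / 2 + 1 := by
  rw [coding, bound_at_zero, bound_at_one, letter_val hM]
  simp

/-- In an image of the Thue–Morse substitution, a repeated letter is followed by the other one. -/
lemma subst_after_repeat {c : ℕ → Bool} {i : ℕ} (h : subst c i = subst c (i + 1)) :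
    subst c (i + 2) = !subst c (i + 1) := by
  obtain ⟨l, rfl | rfl⟩ := i.even_or_odd'
  · rw [subst_even, subst_odd] at h
    simp at h
  · rw [show 2 * l + 1 + 2 = 2 * (l + 1) + 1 by ring, show 2 * l + 1 + 1 = 2 * (l + 1) by ring,
      subst_odd, subst_even]

/-- For even M, state 1 cannot emit the leading digit M/2 + 1 of the bound. For odd M it can, but a
substituted sequence contains no 111, so the second digit then falls below that of the bound; this
requires J ≥ 1. -/
lemma shift_coding_lt_of_true (hM : 1 ≤ M) {J : ℕ} (hJ : Even M ∨ 1 ≤ J) {e : ℕ → Bool} {i : ℕ}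
    (hi : subst^[J] e i = true) :
    toLex (shift i (coding M (subst^[J] e))) < toLex (coding M (bound J)) := by
  by_cases hE : Even M
  · refine lex_lt_iff.2 ⟨0, by simp, ?_⟩
    rw [Fin.lt_def, coding_bound_at_zero hM, shift_apply, coding, zero_add, letter_val hM, hi,
      if_pos hE]
    have : (subst^[J] e (i + 1)).toNat ≤ 1 := Bool.toNat_le _
    have : M / 2 ≥ 1 := by obtain ⟨k, rfl⟩ := hE; omega
    simp only [Bool.toNat_true]
    omega
  · obtain ⟨J, rfl⟩ : ∃ K, J = K + 1 := ⟨J - 1, by have := hJ.resolve_left hE; omega⟩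
    cases hi' : subst^[J + 1] e (i + 1)
    · refine lex_lt_iff.2 ⟨0, by simp, ?_⟩
      rw [Fin.lt_def, coding_bound_at_zero hM, shift_apply, coding, zero_add, letter_val hM, hi',
        if_neg hE]
      simp
    · have hi2 : subst^[J + 1] e (i + 2) = false := by
        rw [Function.iterate_succ_apply'] at hi hi' ⊢
        rw [subst_after_repeat (hi.trans hi'.symm), hi']
        rfl
      refine lex_lt_iff.2 ⟨1, fun j hj => ?_, ?_⟩
      · obtain rfl : j = 0 := by omega
        apply Fin.ext
        rw [coding_bound_at_zero hM, shift_apply, coding, zero_add, letter_val hM, hi', if_neg hE]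
        simp
      · rw [Fin.lt_def, shift_apply, coding, coding, letter_val hM, letter_val hM, if_neg hE,
          if_neg hE, bound_at_two, show 1 + i + 1 = i + 2 by ring, hi2]
        simp

lemma shift_coding_lt (hM : 1 ≤ M) {J : ℕ} (hJ : Even M ∨ 1 ≤ J) {e : ℕ → Bool}
    (he : ∀ N, ∃ i, N ≤ i ∧ e i = false) (i : ℕ) :
    toLex (shift i (coding M (subst^[J] e))) < toLex (coding M (bound J)) := by
  cases hi : subst^[J] e i
  · rw [shift_coding]
    refine coding_lt hM ?_ (shift_iterate_subst_lt J he hi)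
    rw [shift_apply, zero_add, hi, bound_at_zero]
  · exact shift_coding_lt_of_true hM hJ hi

lemma shift_coding_bound_le (hM : 1 ≤ M) {J : ℕ} (hJ : Even M ∨ 1 ≤ J) (i : ℕ) :
    toLex (shift i (coding M (bound J))) ≤ toLex (coding M (bound J)) := by
  cases hi : bound J i
  · rw [shift_coding, coding_le_iff hM (by rw [shift_apply, zero_add, hi, bound_at_zero])]
    exact shift_iterate_subst_le J _ hi
  · exact (shift_coding_lt_of_true hM hJ hi).le

lemma exists_bound_true (J N : ℕ) : ∃ i, N ≤ i ∧ bound J i = true := by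
  cases J with
  | zero => exact ⟨N + 1, by omega, by simp [bound]⟩
  | succ J =>
    rw [bound_succ]
    cases h : bound J N
    · exact ⟨2 * N + 1, by omega, by rw [subst_odd, h]; rfl⟩
    · exact ⟨2 * N, by omega, by rw [subst_even, h]⟩

lemma coding_bound_infinite (hM : 1 ≤ M) (J N : ℕ) : ∃ i, N ≤ i ∧ coding M (bound J) i ≠ 0 := by
  obtain ⟨i, hi, h⟩ := exists_bound_true J (N + 1)
  refine ⟨i - 1, by omega, fun h0 => ?_⟩
  have h1 := congrArg Fin.val h0
  rw [coding, Nat.sub_add_cancel (by omega), h, letter_val hM] at h1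
  have : (bound J (i - 1)).toNat ≤ 1 := Bool.toNat_le _
  simp only [Bool.toNat_true, Fin.val_zero] at h1
  split_ifs at h1 with hE
  · obtain ⟨k, rfl⟩ := hE
    omega

end Coding

/-! ### Thue–Morse digits and the prescribed expansion -/

section Digits

/-- The Thue–Morse sequence with values in `Bool`. -/
def thueMorseBool (i : ℕ) : Bool := decide (thueMorse i = 1)

lemma thueMorse_le_one (i : ℕ) : thueMorse i ≤ 1 := by
  have := Nat.mod_lt (Nat.digits 2 i).sum two_pos
  rw [thueMorse]
  omega

lemma thueMorse_eq_toNat (i : ℕ) : thueMorse i = (thueMorseBool i).toNat := by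
  have := thueMorse_le_one i
  rw [thueMorseBool]
  interval_cases thueMorse i <;> rfl

lemma thueMorseBool_zero : thueMorseBool 0 = false := by
  simp [thueMorseBool, thueMorse]

lemma thueMorseBool_eq (i : ℕ) :
    thueMorseBool i = xor (thueMorseBool (i / 2)) (decide (i % 2 = 1)) := by
  rcases Nat.eq_zero_or_pos i with rfl | hi
  · simp
  · rw [thueMorseBool, thueMorseBool, thueMorse, thueMorse, Nat.digits_def' one_lt_two hi,
      List.sum_cons]
    rcases Nat.mod_two_eq_zero_or_one i with h | h <;>
    rcases Nat.mod_two_eq_zero_or_one (Nat.digits 2 (i / 2)).sum with h' | h' <;>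
    simp [h, h', Nat.add_mod]

lemma thueMorseBool_two_pow (J : ℕ) : thueMorseBool (2 ^ J) = true := by
  induction J with
  | zero => rw [thueMorseBool_eq]; simp [thueMorseBool_zero]
  | succ J ih =>
    rw [thueMorseBool_eq, pow_succ, Nat.mul_div_cancel _ two_pos, ih]
    simp

lemma iterate_subst_apply (J : ℕ) (e : ℕ → Bool) (i : ℕ) :
    subst^[J] e i = xor (e (i / 2 ^ J)) (thueMorseBool (i % 2 ^ J)) := by
  induction J generalizing i with
  | zero => simp [Nat.mod_one, thueMorseBool_zero]
  | succ J ih =>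
    rw [Function.iterate_succ_apply', subst, ih, thueMorseBool_eq (i % 2 ^ (J + 1)), pow_succ',
      Nat.mod_mul_right_div_self, Nat.mod_mul_right_mod, Nat.div_div_eq_div_mul, Bool.xor_assoc]

/-- The exponent `J` such that the block length is `2 ^ J`. -/
def level (M n : ℕ) : ℕ := if Even M then n - 1 else n

lemma blockLength_eq (M n : ℕ) : blockLength M n = 2 ^ level M n := by
  rw [blockLength, level]
  split_ifs <;> rfl

lemma letter_val_int {M : ℕ} (hM : 1 ≤ M) (s t : Bool) :
    ((letter M s t : ℕ) : ℤ) = if Even M then ((M / 2 : ℕ) : ℤ) + t.toNat - s.toNat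
      else ((M / 2 : ℕ) : ℤ) + t.toNat := by
  rw [letter_val hM]
  split_ifs with h
  · have : s.toNat ≤ 1 := Bool.toNat_le s
    obtain ⟨k, rfl⟩ := h
    rw [Nat.cast_sub (by omega)]
    push_cast
    rfl
  · push_cast
    rfl

lemma lam_succ {M : ℕ} (hM : 1 ≤ M) (i : ℕ) :
    lam M (i + 1) = (letter M (thueMorseBool i) (thueMorseBool (i + 1)) : ℕ) := by
  rw [letter_val_int hM, lam, thueMorse_eq_toNat, thueMorse_eq_toNat, Nat.add_sub_cancel]

lemma bound_apply (J i : ℕ) :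
    bound J i = xor (decide (2 ^ J ≤ i)) (thueMorseBool (i % 2 ^ J)) := by
  rw [bound, iterate_subst_apply]
  congr 2
  rw [ne_eq, Nat.div_eq_zero_iff_lt (by positivity), not_lt]

/-- `bound J` is the Thue–Morse block of length L followed by copies of its complement. The first
seam arrives at 1 = τ_L and gives λ_L. Later seams also arrive at 1, where the reflected block would
arrive at 0, whence the increment of the last digit. -/
lemma coding_bound_eq_baseDigit {M : ℕ} (hM : 1 ≤ M) (n i : ℕ) :
    ((coding M (bound (level M n)) i : ℕ) : ℤ) = baseDigit M n i := by
  rw [baseDigit, blockLength_eq]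
  set J := level M n
  have hL : 0 < 2 ^ J := by positivity
  rw [coding, bound_apply, bound_apply]
  by_cases hi : i < 2 ^ J
  · rw [if_pos hi, lam_succ hM, decide_eq_false (not_le.2 hi), Nat.mod_eq_of_lt hi,
      Bool.false_xor]
    rcases (show i + 1 ≤ 2 ^ J from hi).eq_or_lt with h | h
    · rw [h, Nat.mod_self, thueMorseBool_zero, thueMorseBool_two_pow]
      simp
    · rw [decide_eq_false (not_le.2 h), Nat.mod_eq_of_lt h, Bool.false_xor]
  · rw [if_neg hi]
    push Not at hi
    have hmod : (i - 2 ^ J) % 2 ^ J = i % 2 ^ J := (Nat.mod_eq_sub_mod hi).symm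
    have hr := Nat.mod_lt i hL
    rw [hmod, decide_eq_true hi, decide_eq_true (by omega : 2 ^ J ≤ i + 1), Bool.true_xor,
      Bool.true_xor, ← Nat.mod_add_mod i (2 ^ J) 1]
    generalize i % 2 ^ J = r at hr
    dsimp only
    rw [lam_succ hM]
    have hrev : ∀ s t : Bool, ((letter M (!s) (!t) : ℕ) : ℤ) = M - (letter M s t : ℕ) := by
      intro s t
      have := (letter M s t).is_le
      rw [letter_neg hM, Fin.val_rev]
      omega
    rcases (show r + 1 ≤ 2 ^ J from hr).eq_or_lt with h | h
    · rw [if_pos h, h, Nat.mod_self, thueMorseBool_zero, thueMorseBool_two_pow, ← hrev,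
        letter_val_int hM, letter_val_int hM]
      split_ifs
      · simp
        ring
      · simp
    · rw [if_neg h.ne, Nat.mod_eq_of_lt h, hrev, add_zero]

end Digits

/-! ### Sequences in the window are coded -/

section Window

variable {M : ℕ}

/-- All shifts of `y` lie between the reflection of `a` and `a`. -/
def InWindow (a y : Seq M) : Prop :=
  ∀ i, toLex (shift i y) ≤ toLex a ∧ toLex (shift i (reflect y)) ≤ toLex a

lemma InWindow.reflect {a y : Seq M} (h : InWindow a y) : InWindow a (reflect y) := fun i =>
  ⟨(h i).2, by rw [reflect_reflect]; exact (h i).1⟩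

lemma lex_le_head {A : Type*} [LinearOrder A] {x y : ℕ → A} (h : toLex x ≤ toLex y) :
    x 0 ≤ y 0 := by
  by_contra h'
  exact absurd h (not_le.2 (lex_lt_iff.2 ⟨0, by simp, not_le.1 h'⟩))

lemma lex_le_tail {A : Type*} [LinearOrder A] {x y : ℕ → A} (h : toLex x ≤ toLex y)
    (h0 : x 0 = y 0) : toLex (shift 1 x) ≤ toLex (shift 1 y) := by
  by_contra h'
  obtain ⟨m, h1, h2⟩ := lex_lt_iff.1 (not_le.1 h')
  refine absurd h (not_le.2 (lex_lt_iff.2 ⟨m + 1, fun i hi => ?_, h2⟩))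
  cases i with
  | zero => exact h0.symm
  | succ i => exact h1 i (by omega)

/-- The greedy condition is silent after a digit M. But then a also starts with M, and the tail is
at most `shift 1 a`, hence at most a. -/
lemma GreedyCondition.step {a x : Seq M} (hx : GreedyCondition a x)
    (ha : toLex (shift 1 a) ≤ toLex a) {i : ℕ} (h : toLex (shift i x) ≤ toLex a) :
    toLex (shift (i + 1) x) ≤ toLex a := by
  by_cases hi : x i = Fin.last M
  · have h0 : shift i x 0 = a 0 := by
      refine le_antisymm (lex_le_head h) ?_
      rw [shift_apply, zero_add, hi]
      exact Fin.le_last _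
    have h1 := lex_le_tail h h0
    rw [shift_shift, add_comm 1 i] at h1
    exact h1.trans ha
  · exact (hx i hi).le

lemma inWindow_of_greedyCondition {a x : Seq M} (ha : toLex (shift 1 a) ≤ toLex a)
    (hx : GreedyCondition a x) (hx' : GreedyCondition a (reflect x)) {p : ℕ}
    (h : toLex (shift p x) ≤ toLex a) (h' : toLex (shift p (reflect x)) ≤ toLex a) :
    InWindow a (shift p x) := by
  intro i
  rw [← shift_reflect, shift_shift, shift_shift]
  induction i with
  | zero => rw [zero_add]; exact ⟨h, h'⟩
  | succ i ih =>
    rw [add_right_comm]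
    exact ⟨hx.step ha ih.1, hx'.step ha ih.2⟩

/-- The first nonzero digit x_p has a reflection below M, which activates the condition on the
reflected side. The zero before it has activated the other side, and one `GreedyCondition.step`
carries that past p. -/
lemma GreedyCondition.exists_inWindow_of_zero {a x : Seq M} (hM : 1 ≤ M)
    (ha : toLex (shift 1 a) ≤ toLex a)
    (hx : GreedyCondition a x) (hx' : GreedyCondition a (reflect x)) (h0 : x 0 = 0) :
    (∀ i, x i = 0) ∨ ∃ p, (∀ i < p, x i = 0) ∧ InWindow a (shift (p + 1) x) := by
  classical
  by_cases h : ∃ p, x p ≠ 0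
  · right
    obtain ⟨p, hp, hmin⟩ : ∃ p, x p ≠ 0 ∧ ∀ i < p, x i = 0 :=
      ⟨Nat.find h, Nat.find_spec h, fun i hi => not_not.1 (Nat.find_min h hi)⟩
    refine ⟨p, hmin, inWindow_of_greedyCondition ha hx hx' ?_ (hx' p ?_).le⟩
    · obtain _ | p := p
      · exact absurd h0 hp
      refine hx.step ha (hx p ?_).le
      rw [hmin p (by omega)]
      intro h
      have := congrArg Fin.val h
      simp at this
      omega
    · intro h
      apply hp
      rw [reflect_apply] at h
      rw [← Fin.rev_rev (x p), h, Fin.rev_last]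
  · push Not at h
    exact Or.inl h

lemma exists_inWindow {a x : Seq M} (hM : 1 ≤ M) (ha : toLex (shift 1 a) ≤ toLex a)
    (hx : GreedyCondition a x) (hx' : GreedyCondition a (reflect x)) :
    (∃ d, ∀ i, x i = d) ∨ ∃ d p, (∀ i < p, x i = d) ∧ InWindow a (shift (p + 1) x) := by
  by_cases h0 : x 0 = 0
  · rcases hx.exists_inWindow_of_zero hM ha hx' h0 with h | ⟨p, h⟩
    · exact Or.inl ⟨0, h⟩
    · exact Or.inr ⟨0, p, h⟩
  have hrev : ∀ i, reflect x i = 0 → x i = Fin.last M := fun i hi => by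
    rw [← Fin.rev_rev (x i), ← reflect_apply, hi, Fin.rev_zero]
  by_cases h1 : x 0 = Fin.last M
  · rcases hx'.exists_inWindow_of_zero hM ha (by rwa [reflect_reflect])
      (by rw [reflect_apply, h1, Fin.rev_last]) with h | ⟨p, h, h'⟩
    · exact Or.inl ⟨Fin.last M, fun i => hrev i (h i)⟩
    · refine Or.inr ⟨Fin.last M, p, fun i hi => hrev i (h i hi), ?_⟩
      have := h'.reflect
      rwa [shift_reflect, reflect_reflect] at this
  · refine Or.inr ⟨0, 0, by simp, inWindow_of_greedyCondition ha hx hx' (hx 0 h1).le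
      (hx' 0 fun h => h0 ?_).le⟩
    rw [reflect_apply] at h
    rw [← Fin.rev_rev (x 0), h, Fin.rev_last]

lemma coding_bound_le (hM : 1 ≤ M) (J : ℕ) :
    toLex (coding M (bound J)) ≤ toLex (coding M (bound 0)) := by
  rw [coding_le_iff hM (by rw [bound_at_zero, bound_at_zero])]
  exact shift_iterate_subst_le 0 (bound J) (i := 0) (bound_at_zero J)

lemma exists_coding_of_odd (hM : 1 ≤ M) (hE : ¬ Even M) {J : ℕ} {y : Seq M}
    (hy : InWindow (coding M (bound J)) y) : ∃ c, y = coding M c := by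
  have hle : ∀ i, (y i : ℕ) ≤ M / 2 + 1 := by
    intro i
    have := lex_le_head (hy i).1
    rwa [shift_apply, zero_add, Fin.le_def, coding_bound_at_zero hM] at this
  have hge : ∀ i, M / 2 ≤ (y i : ℕ) := by
    intro i
    have := lex_le_head (hy i).2
    rw [shift_apply, zero_add, Fin.le_def, coding_bound_at_zero hM, reflect_apply,
      Fin.val_rev] at this
    have := Nat.not_even_iff.1 hE
    omega
  -- For odd M a digit records only its arrival state, so the initial state is arbitrary.
  refine ⟨fun i => decide (i ≠ 0 ∧ (y (i - 1) : ℕ) = M / 2 + 1), ?_⟩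
  funext i
  apply Fin.ext
  rw [coding, letter_val hM, if_neg hE]
  have h1 := hle i
  have h2 := hge i
  by_cases h : (y i : ℕ) = M / 2 + 1
  · simp [h]
  · simp [h]
    omega

/-- For even `M`, deviations from the middle digit alternate in sign inside the window. -/
lemma InWindow.no_repeat (hM : 1 ≤ M) (hE : Even M) {J : ℕ} {y : Seq M}
    (hy : InWindow (coding M (bound J)) y) {r p : ℕ} (hrp : r < p)
    (hr : (y r : ℕ) = M / 2 + 1) (hmid : ∀ i, r < i → i < p → (y i : ℕ) = M / 2) :
    (y p : ℕ) ≤ M / 2 := by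
  by_contra! hp
  have hb : ∀ i, (coding M (bound 0) i : ℕ) = if i = 0 then M / 2 + 1 else M / 2 := by
    intro i
    rw [coding, letter_val hM, if_pos hE]
    by_cases hi : i = 0 <;> simp [bound, hi]
  -- `bound 0` codes to (M/2 + 1)(M/2)^∞, which a second upward deviation after only middle digits
  -- would exceed.
  refine absurd ((hy r).1.trans (coding_bound_le hM J)) (not_le.2 (lex_lt_iff.2
    ⟨p - r, fun i hi => Fin.ext ?_, ?_⟩))
  · rw [hb, shift_apply]
    by_cases h0 : i = 0
    · rw [if_pos h0, h0, zero_add, hr]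
    · rw [if_neg h0, hmid _ (by omega) (by omega)]
  · rw [Fin.lt_def, hb, if_neg (by omega), shift_apply, Nat.sub_add_cancel hrp.le]
    exact hp

lemma exists_coding_of_even (hM : 1 ≤ M) (hE : Even M) {J : ℕ} {y : Seq M}
    (hy : InWindow (coding M (bound J)) y) : ∃ c, y = coding M c := by
  classical
  have hM2 : M = 2 * (M / 2) := by obtain ⟨k, rfl⟩ := hE; omega
  have hrev : ∀ i, (reflect y i : ℕ) + y i = M := by
    intro i
    have := (y i).is_le
    rw [reflect_apply, Fin.val_rev]
    omega
  have hle : ∀ i, (y i : ℕ) ≤ M / 2 + 1 := by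
    intro i
    have := lex_le_head (hy i).1
    rwa [shift_apply, zero_add, Fin.le_def, coding_bound_at_zero hM] at this
  have hge : ∀ i, M / 2 ≤ (y i : ℕ) + 1 := by
    intro i
    have := lex_le_head (hy i).2
    rw [shift_apply, zero_add, Fin.le_def, coding_bound_at_zero hM] at this
    have := hrev i
    omega
  -- A middle digit keeps the state and a deviation sets it. The initial state must be 1 precisely
  -- when the first deviation is downward.
  let c : ℕ → Bool := fun n => Nat.rec
    (decide (∃ p, (y p : ℕ) < M / 2 ∧ ∀ r < p, (y r : ℕ) = M / 2))
    (fun i b => if (y i : ℕ) = M / 2 then b else decide (M / 2 < (y i : ℕ))) n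
  have hc0 : c 0 = decide (∃ p, (y p : ℕ) < M / 2 ∧ ∀ r < p, (y r : ℕ) = M / 2) := rfl
  have hc : ∀ i, c (i + 1) = if (y i : ℕ) = M / 2 then c i else decide (M / 2 < (y i : ℕ)) :=
    fun i => rfl
  have hist : ∀ p, (c p = c 0 ∧ ∀ r < p, (y r : ℕ) = M / 2) ∨
      ∃ r < p, (y r : ℕ) ≠ M / 2 ∧ c p = decide (M / 2 < (y r : ℕ)) ∧
        ∀ i, r < i → i < p → (y i : ℕ) = M / 2 := by
    intro p
    induction p with
    | zero => exact Or.inl ⟨rfl, by simp⟩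
    | succ p ih =>
      by_cases h : (y p : ℕ) = M / 2
      · rw [hc, if_pos h]
        rcases ih with ⟨h1, h2⟩ | ⟨r, hr, h1, h2, h3⟩
        · refine Or.inl ⟨h1, fun r hr => ?_⟩
          rcases Nat.lt_succ_iff_lt_or_eq.1 hr with hr | rfl
          exacts [h2 r hr, h]
        · refine Or.inr ⟨r, by omega, h1, h2, fun i hi hi' => ?_⟩
          rcases Nat.lt_succ_iff_lt_or_eq.1 hi' with hi' | rfl
          exacts [h3 i hi hi', h]
      · refine Or.inr ⟨p, by omega, h, by rw [hc, if_neg h], fun i hi hi' => by omega⟩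
  have hup : ∀ p, M / 2 < (y p : ℕ) → c p = false := by
    intro p hp
    rcases hist p with ⟨h1, h2⟩ | ⟨r, hr, h1, h2, h3⟩
    · rw [h1, hc0, decide_eq_false_iff_not]
      rintro ⟨s, hs, hs'⟩
      rcases lt_trichotomy s p with h | rfl | h
      · have := h2 s h; omega
      · omega
      · have := hs' p h; omega
    · rw [h2, decide_eq_false_iff_not]
      intro h
      have := hy.no_repeat hM hE hr (by have := hle r; omega) h3
      omega
  have hdown : ∀ p, (y p : ℕ) < M / 2 → c p = true := by
    intro p hp
    rcases hist p with ⟨h1, h2⟩ | ⟨r, hr, h1, h2, h3⟩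
    · rw [h1, hc0, decide_eq_true_iff]
      exact ⟨p, hp, h2⟩
    · rw [h2, decide_eq_true_iff]
      by_contra h
      have := hy.reflect.no_repeat hM hE hr
        (by have := hge r; have := hrev r; omega)
        (fun i hi hi' => by have := h3 i hi hi'; have := hrev i; omega)
      have := hrev p
      omega
  refine ⟨c, funext fun i => Fin.ext ?_⟩
  rw [coding, letter_val hM, if_pos hE, hc]
  have h1 := hle i
  have h2 := hge i
  rcases lt_trichotomy (y i : ℕ) (M / 2) with h | h | h
  · rw [hdown i h, if_neg h.ne, decide_eq_false (by omega)]
    simp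
    omega
  · rw [if_pos h]
    omega
  · rw [hup i h, if_neg h.ne', decide_eq_true h]
    simp
    omega

/-- At a position in state 0 the tail and the bound start in the same state, so the window
inequality decodes; in state 1 the reflected inequality does. -/
lemma InWindow.exists_coding (hM : 1 ≤ M) {J : ℕ} {y : Seq M}
    (hy : InWindow (coding M (bound J)) y) : ∃ c ∈ codes J, y = coding M c := by
  obtain ⟨c, rfl⟩ : ∃ c, y = coding M c := by
    by_cases hE : Even M
    · exact exists_coding_of_even hM hE hy
    · exact exists_coding_of_odd hM hE hy
  refine ⟨c, LevelCondition.mem_codes fun i => ⟨fun hi => ?_, fun hi => ?_⟩, rfl⟩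
  · have := (hy i).1
    rwa [shift_coding,
      coding_le_iff hM (by rw [shift_apply, zero_add, hi, bound_at_zero])] at this
  · have := (hy i).2
    rwa [← coding_neg hM, shift_coding, coding_le_iff hM
      (by rw [shift_apply, zero_add, neg_apply, hi, bound_at_zero]; rfl)] at this

end Window

/-! ### Existence and uniqueness of the bases; univoque sequences -/

section Bases

variable {M : ℕ}

lemma IsSpecialBase.value_eq_one (hM : 1 ≤ M) {n : ℕ} {q : ℝ} (h : IsSpecialBase M n q) :
    value M q (coding M (bound (level M n))) = 1 := by
  obtain ⟨-, x, hx, hx'⟩ := h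
  have : x = coding M (bound (level M n)) := funext fun i => Fin.ext (by
    have h1 := hx' i
    rw [← coding_bound_eq_baseDigit hM] at h1
    exact_mod_cast h1)
  exact this ▸ hx.1.1

lemma existsUnique_isSpecialBase (hM : 1 ≤ M) {n : ℕ} (hn : 1 ≤ n) :
    ∃! q : ℝ, IsSpecialBase M n q := by
  have hJ : Even M ∨ 1 ≤ level M n := by
    by_cases hE : Even M
    · exact Or.inl hE
    · exact Or.inr (by rwa [level, if_neg hE])
  set a := coding M (bound (level M n)) with ha
  have h0 : a 0 ≠ 0 := fun h => by
    have h1 := coding_bound_at_zero hM (level M n)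
    rw [← ha, h] at h1
    simp at h1
  obtain ⟨j, hj, hj'⟩ := coding_bound_infinite hM (level M n) 1
  obtain ⟨q, hq, hv⟩ := exists_base hM h0 (by omega : j ≠ 0) hj'
  refine ⟨q, ⟨hq, a, isQuasiGreedy_of_lex hq.1 hv (shift_coding_bound_le hM hJ)
    (coding_bound_infinite hM _), coding_bound_eq_baseDigit hM n⟩, fun p hp => ?_⟩
  have hp1 := hp.1.1
  have hpv : value M p a = 1 := hp.value_eq_one hM
  rcases lt_trichotomy p q with h | h | h
  · have := value_lt_of_lt hp1 h h0
    linarith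
  · exact h
  · have := value_lt_of_lt hq.1 h h0
    linarith

/-- Univoque sequences are constant, or a constant word followed by one digit and a coded
sequence. -/
lemma exists_code_of_mem (hM : 1 ≤ M) {q : ℝ} (hq : 1 < q) (hqM : q ≤ M + 1) {J : ℕ}
    (hJ : Even M ∨ 1 ≤ J) (hv : value M q (coding M (bound J)) = 1) {x : Seq M}
    (hx : x ∈ symbolicUnivoqueSet M q) :
    (∃ d, ∀ i, x i = d) ∨
      ∃ d p, (∀ i < p, x i = d) ∧ ∃ c ∈ codes J, shift (p + 1) x = coding M c := by
  have hs := shift_coding_bound_le hM hJ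
  rcases exists_inWindow hM (hs 1) (greedyCondition_of_mem hq hqM hv hs hx)
    (greedyCondition_of_mem hq hqM hv hs (reflect_mem_symbolicUnivoqueSet hq hx)) with
    h | ⟨d, p, h, h'⟩
  · exact Or.inl h
  · exact Or.inr ⟨d, p, h, h'.exists_coding hM⟩

/-- This is the source of entropy: e is essentially free. Infinitely many 0s make every inequality
strict, and infinitely many 1s do the same for the reflection, which codes the complement of e. -/
lemma coding_iterate_subst_mem (hM : 1 ≤ M) {q : ℝ} (hq : 1 < q) {J : ℕ}
    (hJ : Even M ∨ 1 ≤ J) (hv : value M q (coding M (bound J)) = 1) {e : ℕ → Bool}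
    (he : ∀ N, ∃ i, N ≤ i ∧ e i = false) (he' : ∀ N, ∃ i, N ≤ i ∧ e i = true) :
    coding M (subst^[J] e) ∈ symbolicUnivoqueSet M q := by
  refine mem_symbolicUnivoqueSet_of_greedyCondition hq hv (coding_bound_infinite hM J)
    (fun i _ => shift_coding_lt hM hJ he _) fun i _ => ?_
  rw [← coding_neg hM, ← iterate_subst_neg]
  refine shift_coding_lt hM hJ (fun N => ?_) _
  obtain ⟨i, hi, h⟩ := he' N
  exact ⟨i, hi, by rw [neg_apply, h]; rfl⟩

end Bases

/-! ### Counting prefixes -/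

section Counting

/-- The set of words of length `m` that begin a sequence of `X`. -/
def words {A : Type*} (m : ℕ) (X : Set (ℕ → A)) : Set (Fin m → A) :=
  {w | ∃ x ∈ X, ∀ i : Fin m, w i = x i}

lemma prefixes_eq_words {M : ℕ} (m : ℕ) (X : Set (Seq M)) : prefixes m X = words m X := rfl

/-- A word of length m is determined by a parameter and r letters of Y; since `G` looks no further
than these r letters, padding with `default` is harmless. -/
lemma ncard_words_le {A B P : Type*} [Finite A] [Inhabited A] [Fintype P] {X : Set (ℕ → B)}
    {Y : Set (ℕ → A)} {m r : ℕ} (G : P → (ℕ → A) → ℕ → B)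
    (hG : ∀ p y y', (∀ i < r, y i = y' i) → ∀ i < m, G p y i = G p y' i)
    (hX : ∀ x ∈ X, ∃ p, ∃ y ∈ Y, ∀ i < m, x i = G p y i) :
    (words m X).ncard ≤ Fintype.card P * (words r Y).ncard := by
  let f : P × (Fin r → A) → Fin m → B := fun pw i =>
    G pw.1 (fun j => if h : j < r then pw.2 ⟨j, h⟩ else default) i
  have hfin : (Set.univ ×ˢ words r Y : Set (P × (Fin r → A))).Finite := Set.toFinite _
  have hsub : words m X ⊆ f '' (Set.univ ×ˢ words r Y) := by
    rintro w ⟨x, hx, hw⟩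
    obtain ⟨p, y, hy, hxy⟩ := hX x hx
    refine ⟨(p, fun i => y i), ⟨trivial, y, hy, fun i => rfl⟩, funext fun i => ?_⟩
    rw [hw, hxy i i.2]
    exact hG _ _ _ (fun j hj => by simp [hj]) i i.2
  calc (words m X).ncard ≤ (f '' (Set.univ ×ˢ words r Y)).ncard :=
        Set.ncard_le_ncard hsub (hfin.image f)
    _ ≤ (Set.univ ×ˢ words r Y : Set (P × (Fin r → A))).ncard := Set.ncard_image_le hfin
    _ = _ := by rw [Set.ncard_prod, Set.ncard_univ, Nat.card_eq_fintype_card]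

/-- The numbers `b m` are bounded by a polynomial times `2 ^ (m / L)`. -/
def HasGrowth (b : ℕ → ℕ) (L : ℝ) : Prop :=
  ∃ C D : ℕ, ∀ m : ℕ, (b m : ℝ) ≤ C * ((m : ℝ) + 1) ^ D * (2 : ℝ) ^ ((m : ℝ) / L)

lemma HasGrowth.of_le {b b' r : ℕ → ℕ} {L L' : ℝ} {K : ℕ} (h : HasGrowth b L)
    (hb : ∀ m, b' m ≤ K * (m + 1) * b (r m)) (hr : ∀ m, r m + 1 ≤ 2 * (m + 1))
    (hL : ∀ m : ℕ, (r m : ℝ) / L ≤ m / L' + 1) : HasGrowth b' L' := by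
  obtain ⟨C, D, h⟩ := h
  -- Passing from r m + 1 to 2(m + 1) costs 2^D, and the extra 1 in the exponent costs one more
  -- factor 2.
  refine ⟨K * C * 2 ^ (D + 1), D + 1, fun m => ?_⟩
  have h1 : ((r m : ℝ) + 1) ≤ 2 * (m + 1) := by exact_mod_cast hr m
  have h2 : (b' m : ℝ) ≤ K * (m + 1) * b (r m) := by exact_mod_cast hb m
  calc (b' m : ℝ) ≤ K * (m + 1) * b (r m) := h2
    _ ≤ K * (m + 1) * (C * ((r m : ℝ) + 1) ^ D * (2 : ℝ) ^ ((r m : ℝ) / L)) := by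
        gcongr; exact h _
    _ ≤ K * (m + 1) * (C * (2 * ((m : ℝ) + 1)) ^ D * (2 : ℝ) ^ ((m : ℝ) / L' + 1)) := by
        gcongr
        · norm_num
        · exact hL m
    _ = _ := by
        rw [Real.rpow_add two_pos, Real.rpow_one, mul_pow]
        push_cast
        ring

/-- One level costs the choice of a constant letter and a prefix length, at most 2(m + 1)
possibilities, and the rest depends on m/2 + 1 letters of the previous level. -/
lemma hasGrowth_codes (J : ℕ) : HasGrowth (fun m => (words m (codes J)).ncard) (2 ^ J) := by
  induction J with
  | zero =>
    refine ⟨1, 0, fun m => ?_⟩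
    have h1 : (words m (codes 0)).ncard ≤ 2 ^ m := by
      refine (Set.ncard_le_card _).trans ?_
      simp
    have h2 : ((words m (codes 0)).ncard : ℝ) ≤ 2 ^ m := by exact_mod_cast h1
    simpa using h2
  | succ J ih =>
    refine ih.of_le (r := fun m => m / 2 + 1) (K := 2) (fun m => ?_) (fun m => by omega)
      fun m => ?_
    · have := ncard_words_le (P := Bool × Fin (m + 1)) (X := codes (J + 1)) (Y := codes J)
        (m := m) (r := m / 2 + 1) (fun p y i => if i < p.2 then p.1 else subst y (i - p.2))
        (fun p y y' h i hi => by
          split_ifs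
          · rfl
          · rw [subst, subst, h _ (by omega)])
        (by
          rintro x (⟨a, ha⟩ | ⟨a, p, c, hc, hp, hs⟩)
          · obtain ⟨y, hy⟩ := codes_nonempty J
            exact ⟨(a, Fin.last m), y, hy, fun i hi => by simp [ha, hi]⟩
          -- Prefix lengths beyond m are indistinguishable, so they are capped at m.
          · refine ⟨(a, ⟨min p m, by omega⟩), c, hc, fun i hi => ?_⟩
            dsimp only
            split_ifs with h
            · exact hp i (by omega)
            · rw [show min p m = p by omega, ← hs, shift_apply, Nat.sub_add_cancel (by omega)])
      simpa using this
    · have h1 : ((m / 2 : ℕ) : ℝ) ≤ m / 2 := Nat.cast_div_le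
      have h2 : (1 : ℝ) ≤ 2 ^ J := one_le_pow₀ one_le_two
      push_cast at h1 ⊢
      rw [add_div, pow_succ', ← div_div]
      gcongr
      exact div_le_one_of_le₀ h2 (by positivity)

lemma hasGrowth_univoque {M : ℕ} (hM : 1 ≤ M) {q : ℝ} (hq : 1 < q) (hqM : q ≤ M + 1) {J : ℕ}
    (hJ : Even M ∨ 1 ≤ J) (hv : value M q (coding M (bound J)) = 1) :
    HasGrowth (fun m => (prefixes m (symbolicUnivoqueSet M q)).ncard) (2 ^ J) := by
  refine (hasGrowth_codes J).of_le (r := fun m => m + 1) (K := (M + 1) * (M + 1)) (fun m => ?_)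
    (fun m => by omega) fun m => ?_
  · have := ncard_words_le (P := (Fin (M + 1) × Fin (M + 1)) × Fin (m + 1))
      (X := symbolicUnivoqueSet M q) (Y := codes J) (m := m) (r := m + 1)
      (fun p y i => if i < p.2 then p.1.1 else if i = p.2 then p.1.2
        else coding M y (i - (p.2 + 1)))
      (fun p y y' h i hi => by
        split_ifs
        · rfl
        · rfl
        · rw [coding, coding, h _ (by omega), h _ (by omega)])
      (by
        intro x hx
        rcases exists_code_of_mem hM hq hqM hJ hv hx with ⟨a, ha⟩ | ⟨a, p, hp, c, hc, hs⟩
        · obtain ⟨y, hy⟩ := codes_nonempty J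
          exact ⟨((a, a), Fin.last m), y, hy, fun i hi => by simp [ha, hi]⟩
        · refine ⟨((a, x p), ⟨min p m, by omega⟩), c, hc, fun i hi => ?_⟩
          dsimp only
          split_ifs with h h'
          · exact hp i (by omega)
          · rw [show i = p by omega]
          · rw [show min p m = p by omega, ← hs, shift_apply, Nat.sub_add_cancel (by omega)])
    simpa [prefixes_eq_words] using this
  · have h2 : (1 : ℝ) ≤ 2 ^ J := one_le_pow₀ one_le_two
    push_cast
    rw [add_div]
    gcongr
    exact div_le_one_of_le₀ h2 (by positivity)

lemma letter_right_injective {M : ℕ} (hM : 1 ≤ M) (s : Bool) :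
    Function.Injective (letter M s) := by
  intro t t' h
  rcases lt_trichotomy t t' with h' | h' | h'
  · exact absurd h (letter_lt hM s h').ne
  · exact h'
  · exact absurd h (letter_lt hM s h').ne'

lemma eq_of_coding_eq {M : ℕ} (hM : 1 ≤ M) {c d : ℕ → Bool} (h0 : c 0 = d 0) {m : ℕ}
    (h : ∀ i < m, coding M c i = coding M d i) {i : ℕ} (hi : i ≤ m) : c i = d i := by
  induction i with
  | zero => exact h0
  | succ i ih =>
    have h1 := h i (by omega)
    rw [coding, coding, ih (by omega)] at h1
    exact letter_right_injective hM _ h1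

/-- The sequence `0 u` followed by an alternating tail. -/
def freeWord {r : ℕ} (u : Fin r → Bool) : ℕ → Bool := fun i =>
  if h : i ≠ 0 ∧ i - 1 < r then u ⟨i - 1, h.2⟩ else decide (i % 2 = 1)

lemma freeWord_frequently {r : ℕ} (u : Fin r → Bool) (b : Bool) (N : ℕ) :
    ∃ i, N ≤ i ∧ freeWord u i = b := by
  refine ⟨2 * (N + r + 1) + b.toNat, by omega, ?_⟩
  rw [freeWord, dif_neg (by omega)]
  cases b <;> simp

lemma two_pow_le_ncard_prefixes {M : ℕ} (hM : 1 ≤ M) {q : ℝ} (hq : 1 < q) {J : ℕ}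
    (hJ : Even M ∨ 1 ≤ J) (hv : value M q (coding M (bound J)) = 1) (m : ℕ) :
    2 ^ (m / 2 ^ J) ≤ (prefixes m (symbolicUnivoqueSet M q)).ncard := by
  let F : (Fin (m / 2 ^ J) → Bool) → Fin m → Fin (M + 1) := fun u i =>
    coding M (subst^[J] (freeWord u)) i
  have hsub : Set.range F ⊆ prefixes m (symbolicUnivoqueSet M q) := by
    rintro _ ⟨u, rfl⟩
    exact ⟨_, coding_iterate_subst_mem hM hq hJ hv (freeWord_frequently u false)
      (freeWord_frequently u true), fun i => rfl⟩
  have hinj : Function.Injective F := by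
    intro u u' h
    have hF : ∀ i < m, coding M (subst^[J] (freeWord u)) i
        = coding M (subst^[J] (freeWord u')) i := fun i hi => congrFun h ⟨i, hi⟩
    have h0 : subst^[J] (freeWord u) 0 = subst^[J] (freeWord u') 0 := by
      simp [iterate_subst_apply, freeWord]
    funext l
    -- The letter u_l is the state at position (l + 1) 2^J, since `freeWord` spends its first letter
    -- on fixing the initial state. The m digits determine all states up to m.
    have hl : (l + 1) * 2 ^ J ≤ m :=
      (Nat.mul_le_mul_right _ l.2).trans (Nat.div_mul_le_self m (2 ^ J))
    have h1 := eq_of_coding_eq hM h0 hF hl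
    simpa [iterate_subst_apply, thueMorseBool_zero, freeWord] using h1
  calc 2 ^ (m / 2 ^ J) = (Set.range F).ncard := by
        rw [← Set.image_univ, Set.ncard_image_of_injective _ hinj, Set.ncard_univ]
        simp
    _ ≤ _ := Set.ncard_le_ncard hsub (Set.toFinite _)

/-- Rounding in m / L costs at most log 2 and the polynomial factor costs O(log m); both vanish
after division by m. -/
lemma tendsto_log_div_of_hasGrowth {b : ℕ → ℕ} {L : ℕ} (hL : 0 < L) (hlow : ∀ m, 2 ^ (m / L) ≤ b m)
    (hup : HasGrowth b L) :
    Tendsto (fun m : ℕ => Real.log (b m : ℝ) / (m : ℝ)) atTop (𝓝 (Real.log 2 / L)) := by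
  obtain ⟨C, D, hup⟩ := hup
  have hlog2 : 0 < Real.log 2 := Real.log_pos one_lt_two
  have hL' : (0 : ℝ) < L := by exact_mod_cast hL
  have hb : ∀ m, (0 : ℝ) < b m := fun m => by
    have := (Nat.two_pow_pos (m / L)).trans_le (hlow m)
    exact_mod_cast this
  have hC : (0 : ℝ) < C := by
    rcases Nat.eq_zero_or_pos C with rfl | h
    · have h1 := hup 0
      have h2 := hb 0
      simp at h1
      simp [h1] at h2
    · exact_mod_cast h
  have hinv : ∀ K : ℝ, Tendsto (fun m : ℕ => K / (m : ℝ)) atTop (𝓝 0) :=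
    fun K => tendsto_const_div_atTop_nhds_zero_nat K
  have hlogm : Tendsto (fun m : ℕ => Real.log (m : ℝ) / (m : ℝ)) atTop (𝓝 0) :=
    Real.isLittleO_log_id_atTop.tendsto_div_nhds_zero.comp tendsto_natCast_atTop_atTop
  have hlo : Tendsto (fun m : ℕ => Real.log 2 / L - Real.log 2 / (m : ℝ)) atTop
      (𝓝 (Real.log 2 / L)) := by
    simpa using (hinv (Real.log 2)).const_sub (Real.log 2 / L)
  have hhi : Tendsto (fun m : ℕ => (Real.log C + D * Real.log 2) / (m : ℝ)
      + D * (Real.log (m : ℝ) / (m : ℝ)) + Real.log 2 / L) atTop (𝓝 (Real.log 2 / L)) := by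
    simpa using ((hinv (Real.log C + D * Real.log 2)).add (hlogm.const_mul (D : ℝ))).add_const
      (Real.log 2 / L)
  refine tendsto_of_tendsto_of_tendsto_of_le_of_le' hlo hhi ?_ ?_
  · filter_upwards [eventually_gt_atTop 0] with m hm
    have hm' : (0 : ℝ) < m := by exact_mod_cast hm
    have h1 : ((2 : ℝ) ^ (m / L)) ≤ b m := by exact_mod_cast hlow m
    have h2 := Real.log_le_log (by positivity) h1
    rw [Real.log_pow] at h2
    have h3 : (m : ℝ) / L < (m / L : ℕ) + 1 := by
      rw [div_lt_iff₀ hL']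
      have := Nat.lt_div_mul_add (a := m) hL
      have : m < (m / L + 1) * L := by linarith
      exact_mod_cast this
    rw [le_div_iff₀ hm']
    calc _ = ((m : ℝ) / L - 1) * Real.log 2 := by field_simp
      _ ≤ (m / L : ℕ) * Real.log 2 := by gcongr; linarith
      _ ≤ _ := h2
  · filter_upwards [eventually_gt_atTop 0] with m hm
    have hm' : (0 : ℝ) < m := by exact_mod_cast hm
    have hm1 : (1 : ℝ) ≤ m := by exact_mod_cast hm
    have h1 := Real.log_le_log (hb m) (hup m)
    rw [Real.log_mul (by positivity) (by positivity), Real.log_mul (by positivity) (by positivity),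
      Real.log_pow, Real.log_rpow two_pos] at h1
    have h2 : Real.log ((m : ℝ) + 1) ≤ Real.log 2 + Real.log m := by
      rw [← Real.log_mul two_ne_zero hm'.ne']
      exact Real.log_le_log (by positivity) (by linarith)
    rw [div_le_iff₀ hm']
    calc _ ≤ Real.log C + D * Real.log ((m : ℝ) + 1) + m / L * Real.log 2 := h1
      _ ≤ Real.log C + D * (Real.log 2 + Real.log m) + m / L * Real.log 2 := by gcongr
      _ = _ := by field_simp; ring

end Counting

/-! ### The entropy at the special bases -/

lemma IsSpecialBase.hasEntropy {M : ℕ} (hM : 1 ≤ M) {n : ℕ} (hn : 1 ≤ n) {q : ℝ}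
    (h : IsSpecialBase M n q) :
    HasEntropy (symbolicUnivoqueSet M q) (entropyConst M * Real.log 2 / 2 ^ (n - 1)) := by
  have hv := h.value_eq_one hM
  obtain ⟨hq, hqM⟩ := h.1
  have hJ : Even M ∨ 1 ≤ level M n := by
    by_cases hE : Even M
    · exact Or.inl hE
    · exact Or.inr (by rwa [level, if_neg hE])
  have h1 := tendsto_log_div_of_hasGrowth (L := 2 ^ level M n) (by positivity)
    (two_pow_le_ncard_prefixes hM hq hJ hv)
    (by simpa using hasGrowth_univoque hM hq hqM hJ hv)
  -- For odd M the block length is 2^n rather than 2^(n-1), which is the factor 1/2 in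
  -- `entropyConst`.
  have h2 : entropyConst M * Real.log 2 / 2 ^ (n - 1) = Real.log 2 / (2 ^ level M n : ℕ) := by
    rw [entropyConst, level]
    split_ifs
    · push_cast
      ring
    · obtain ⟨k, rfl⟩ : ∃ k, n = k + 1 := ⟨n - 1, by omega⟩
      push_cast
      rw [pow_succ]
      field_simp
  rw [h2]
  exact h1

end NonIntegerBase

theorem corollary3p5 (M : ℕ) (hM : 1 ≤ M) :
    (∀ n : ℕ, 1 ≤ n →
      (∃! q : ℝ, NonIntegerBase.IsSpecialBase M n q) ∧
      ∀ q : ℝ, NonIntegerBase.IsSpecialBase M n q →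
        NonIntegerBase.HasEntropy (NonIntegerBase.symbolicUnivoqueSet M q)
          (NonIntegerBase.entropyConst M * Real.log 2 / 2 ^ (n - 1))) ∧
    (∃! q : ℝ, NonIntegerBase.IsTransitiveBase M q) ∧
    ∀ q : ℝ, NonIntegerBase.IsTransitiveBase M q →
      NonIntegerBase.HasEntropy (NonIntegerBase.symbolicUnivoqueSet M q)
        (NonIntegerBase.entropyConst M * Real.log 2) := by
  refine ⟨fun n hn => ⟨NonIntegerBase.existsUnique_isSpecialBase hM hn,
    fun q hq => hq.hasEntropy hM hn⟩,
    NonIntegerBase.existsUnique_isSpecialBase hM le_rfl, fun q hq => ?_⟩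
  simpa using NonIntegerBase.IsSpecialBase.hasEntropy hM le_rfl hq
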